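/- Let $(R,\mathfrak m)$ be an excellent Noetherian local domain. A filtration $\mathfrak c_\bullet=\{\mathfrak c_p\}_{p\ge1}$ of $R$ is a sequence of proper ideals with $\mathfrak c_p\mathfrak c_{q}\subseteq\mathfrak c_{p+q}$ and $\mathfrak c_{p+1}\subseteq\mathfrak c_p$ for all $p,q\ge 1$. For filtrations $\mathfrak a_\bullet,\mathfrak b_\bullet$ put $$\mathcal L_{\mathfrak b_\bullet}(\mathfrak a_\bullet)=\inf\Big\{\tfrac qp : p,q\ge1,\ \mathfrak b_{qt}\subseteq\overline{\mathfrak a_{pt}}\text{ for all } t\gg1\Big\}\in[0,\infty],$$ where $\overline{I}$ is the integral closure of an ideal $I$ and $\inf\emptyset=\infty$. For a valuation $v$ that is nonnegative on $R$ (with $v(0)=\infty$) put $v(I)=\min_{x\in I}v(x)$ and $v(\mathfrak c_\bullet)=\lim_{p}v(\mathfrak c_p)/p=\inf_{p\ge1}v(\mathfrak c_p)/p\in[0,\infty]$. Let $\mathfrak a_\bullet$ be a filtration with $\mathfrak a_1\neq0$ whose Rees algebra $\mathcal R(\mathfrak a_\bullet)=\bigoplus_{p\ge0}\mathfrak a_pT^p\subseteq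 R[T]$ (where $\mathfrak a_0=R$) is finitely generated as an $R$-algebra. Let $\overline{\mathcal R(\mathfrak a_\bullet)}$ be its integral closure in its fraction field and $\overline Y=\operatorname{Proj}\overline{\mathcal R(\mathfrak a_\bullet)}$. Then there is a finite nonempty set $\{v_1,\dots,v_r\}$ of divisorial valuations of $\operatorname{Frac}(R)$, depending only on $\mathfrak a_\bullet$, such that each $v_i$ is the order of vanishing $\operatorname{ord}_{E_i}$ along a prime divisor $E_i$ of $\overline Y$ (the local ring of $\overline Y$ at the generic point of $E_i$ being a discrete valuation ring) and is positive on $\mathfrak a_1$ (so $v_i$ is centered at $\mathfrak m$ whenever $\mathfrak a_1$ is $\mathfrak m$-primary), with the following property: for every filtration $\mathfrak b_\bullet$ of $R$ with $v_i(\mathfrak b_\bullet)>0$ for all $i$, $$\mathcal L_{\mathfrak b_\bullet}(\mathfrak a_\bullet)=\max_{1\le i\le r}\frac{v_i(\mathfrak a_\bullet)}{v_i(\mathfrak b_\bullet)}$$ (where a finite number divided by $\infty$ is $0$, which occurs only for $\mathfrak b_\bullet=0$). -/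

import Mathlib

open Polynomial
open scoped TensorProduct ENNReal

noncomputable section

/-! ### Excellent rings -/

/-- A (Noetherian) ring is catenary if any two saturated chains of primes with the same
endpoints have the same length.  A saturated chain is a series for the covering relation `⋖`. -/
def IsCatenaryRing (R : Type*) [CommRing R] : Prop :=
  ∀ s t : RelSeries {x : PrimeSpectrum R × PrimeSpectrum R | x.1 ⋖ x.2},
    s.head = t.head → s.last = t.last → s.length = t.length

/-- Every algebra of finite type is catenary. -/
def IsUniversallyCatenaryRing (R : Type*) [CommRing R] : Prop :=
  ∀ n : ℕ, ∀ I : Ideal (MvPolynomial (Fin n) R), IsCatenaryRing (MvPolynomial (Fin n) R ⧸ I)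

/-- A `k`-algebra `A` is geometrically regular if `L ⊗ A` is a (Noetherian) regular ring for
every finite field extension `L / k`. -/
def IsGeometricallyRegular.{u, v} (k : Type u) (A : Type v) [Field k] [CommRing A]
    [Algebra k A] : Prop :=
  ∀ (L : Type u) [Field L] [Algebra k L] [FiniteDimensional k L], IsRegularRing (L ⊗[k] A)

/-- The G-ring condition: for every prime `p`, all fibres of the completion map from the local
ring `R_p` to its completion are geometrically regular. -/
def HasGeometricallyRegularFormalFibers (R : Type*) [CommRing R] : Prop :=
  ∀ (p : Ideal R) [p.IsPrime] (q : Ideal (Localization.AtPrime p)) [q.IsPrime],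
    IsGeometricallyRegular q.ResidueField
      (q.Fiber (AdicCompletion (IsLocalRing.maximalIdeal (Localization.AtPrime p))
        (Localization.AtPrime p)))

/-- The J-2 condition: every algebra of finite type has open regular locus. -/
def HasOpenRegularLoci.{u} (R : Type u) [CommRing R] : Prop :=
  ∀ (S : Type u) [CommRing S] [Algebra R S] [Algebra.FiniteType R S],
    IsOpen {p : PrimeSpectrum S | IsRegularLocalRing (Localization.AtPrime p.asIdeal)}

/-- Excellent rings. -/
class IsExcellentRing (R : Type*) [CommRing R] : Prop extends IsNoetherianRing R where
  universallyCatenary : IsUniversallyCatenaryRing R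
  formalFibers : HasGeometricallyRegularFormalFibers R
  regularLoci : HasOpenRegularLoci R

/-! ### Integral closure of ideals -/

/-- `x` satisfies an equation `x ^ n + c 1 * x ^ (n - 1) + ⋯ + c n = 0` with `n ≥ 1` and
`c i ∈ I ^ i`. -/
def Ideal.IsIntegralElem {R : Type*} [CommRing R] (I : Ideal R) (x : R) : Prop :=
  ∃ n : ℕ, 1 ≤ n ∧ ∃ c : ℕ → R, (∀ i, c i ∈ I ^ i) ∧
    x ^ n + ∑ i ∈ Finset.Icc 1 n, c i * x ^ (n - i) = 0

/-- The integral closure of an ideal, as a set. -/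
def Ideal.integralClosureSet {R : Type*} [CommRing R] (I : Ideal R) : Set R :=
  {x | I.IsIntegralElem x}

/-! ### Filtrations -/

/-- A filtration of proper ideals `a_1 ⊇ a_2 ⊇ ⋯` with `a_p a_q ⊆ a_{p+q}`, completed by
`a_0 = R`. -/
structure IdealFiltration (R : Type*) [CommRing R] where
  ideal : ℕ → Ideal R
  ideal_zero : ideal 0 = ⊤
  ideal_ne_top : ∀ p, 1 ≤ p → ideal p ≠ ⊤
  ideal_mul_le : ∀ p q, ideal p * ideal q ≤ ideal (p + q)
  ideal_succ_le : ∀ p, ideal (p + 1) ≤ ideal p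

namespace IdealFiltration

section Loj

variable {R : Type*} [CommRing R]

/-- The Łojasiewicz exponent `L_b(a)`, the infimum in `[0, ∞]` of all `q / p` with `p, q ≥ 1` such
that `b_{qt}` is contained in the integral closure of `a_{pt}` for all large `t`. -/
def lojasiewicz (b a : IdealFiltration R) : ℝ≥0∞ :=
  sInf {l | ∃ p q : ℕ, 1 ≤ p ∧ 1 ≤ q ∧
    (∀ᶠ t : ℕ in Filter.atTop, (b.ideal (q * t) : Set R) ⊆ (a.ideal (p * t)).integralClosureSet) ∧
    l = (q : ℝ≥0∞) / (p : ℝ≥0∞)}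

/-- `v(I) = min {v(x) : x ∈ I}`. -/
def _root_.AddValuation.idealValue (v : AddValuation R ℕ∞) (I : Ideal R) : ℕ∞ :=
  ⨅ x ∈ I, v x

/-- The asymptotic value `v(a) = inf_{p ≥ 1} v(a_p) / p`, which by subadditivity is also the limit
of `v(a_p) / p`. -/
def asymptoticValue (v : AddValuation R ℕ∞) (a : IdealFiltration R) : ℝ≥0∞ :=
  ⨅ p : ℕ, ⨅ _ : 1 ≤ p, (v.idealValue (a.ideal p) : ℝ≥0∞) / (p : ℝ≥0∞)

/-- The Rees algebra `⨁ a_p T^p`, as a subalgebra of `R[T]`. -/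
def rees (a : IdealFiltration R) : Subalgebra R R[X] where
  carrier := {f | ∀ i, f.coeff i ∈ a.ideal i}
  mul_mem' {f g} hf hg i := by
    rw [coeff_mul]
    apply Ideal.sum_mem
    rintro ⟨j, k⟩ e
    have e' : j + k = i := Finset.HasAntidiagonal.mem_antidiagonal.mp e
    rw [← e']
    exact a.ideal_mul_le j k (Ideal.mul_mem_mul (hf j) (hg k))
  add_mem' {f g} hf hg i := by
    rw [coeff_add]
    exact Ideal.add_mem _ (hf i) (hg i)
  algebraMap_mem' r i := by
    rw [Polynomial.algebraMap_apply, coeff_C]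
    split_ifs with h
    · subst h
      simp [a.ideal_zero]
    · simp

end Loj

/-! ### The normalized Rees algebra and its `Proj` -/

section Proj

universe u

variable {R : Type u} [CommRing R] (K : Type u) [Field K] [Algebra R K]

/-- The Rees algebra viewed inside `K[T]`, where `K = Frac R`. -/
def reesInK (a : IdealFiltration R) : Subalgebra R K[X] :=
  a.rees.map (Polynomial.mapAlgHom (Algebra.ofId R K))

/-- The integral closure of the Rees algebra in `K[T]`.  If `a_1 ≠ 0` then the
Rees algebra has fraction field `K(T)`; as `K[T]` is integrally closed, this is then the integral
closure in the fraction field, see `mem_range_normalizedRees_of_isIntegral`. -/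
def normalizedRees (a : IdealFiltration R) : Subalgebra R K[X] :=
  (integralClosure (a.reesInK K) K[X]).restrictScalars R

lemma mem_normalizedRees (a : IdealFiltration R) {f : K[X]} :
    f ∈ a.normalizedRees K ↔ IsIntegral (a.reesInK K) f := Iff.rfl

/-- Taking the integral closure in `K(T)` gives nothing new. -/
lemma mem_range_normalizedRees_of_isIntegral (a : IdealFiltration R)
    {x : FractionRing K[X]} (hx : IsIntegral (a.reesInK K) x) :
    ∃ f ∈ a.normalizedRees K, algebraMap K[X] _ f = x := by
  obtain ⟨f, rfl⟩ := IsIntegrallyClosed.isIntegral_iff.mp (hx.tower_top (A := K[X]))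
  refine ⟨f, ?_, rfl⟩
  exact (isIntegral_algebraMap_iff (IsFractionRing.injective _ _)).mp hx

lemma monomial_coeff_mem_reesInK (a : IdealFiltration R) {f : K[X]}
    (hf : f ∈ a.reesInK K) (i : ℕ) : monomial i (f.coeff i) ∈ a.reesInK K := by
  obtain ⟨g, hg, rfl⟩ := hf
  refine ⟨monomial i (g.coeff i), fun j ↦ ?_, ?_⟩
  · rw [coeff_monomial]
    split_ifs with h
    · subst h; exact hg i
    · simp
  · simp [Polynomial.map_monomial]

/-- The ring homomorphism `K[T] → K[T][U]`, `T ↦ T U`. -/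
def spread (K : Type u) [Field K] : K[X] →+* K[X][X] :=
  Polynomial.eval₂RingHom ((C : K[X] →+* K[X][X]).comp C) (C X * X)

lemma coeff_spread {K : Type u} [Field K] (f : K[X]) (i : ℕ) :
    (spread K f).coeff i = monomial i (f.coeff i) := by
  induction f using Polynomial.induction_on' with
  | add p q hp hq => simp [hp, hq]
  | monomial n c =>
    simp only [spread, coe_eval₂RingHom, eval₂_monomial, RingHom.comp_apply, mul_pow, ← C_pow,
      ← mul_assoc, ← C_mul, coeff_C_mul_X_pow, coeff_monomial]
    by_cases h : i = n
    · subst h; simp [C_mul_X_pow_eq_monomial]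
    · simp [h, Ne.symm h]

/-- Homogeneous components of integral elements are integral. -/
lemma isIntegral_monomial_coeff {S K : Type u} [CommRing S] [Field K] [Algebra S K[X]]
    (hinj : Function.Injective (algebraMap S K[X]))
    (hS : ∀ (s : S) (i : ℕ), ∃ s' : S,
      algebraMap S K[X] s' = monomial i ((algebraMap S K[X] s).coeff i))
    {f : K[X]} (hf : IsIntegral S f) (i : ℕ) : IsIntegral S (monomial i (f.coeff i)) := by
  let _ : Algebra S[X] K[X][X] := Polynomial.algebra S K[X]
  let m : S[X] →+* K[X][X] := Polynomial.mapRingHom (algebraMap S K[X])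
  have hm : Function.Injective m := Polynomial.map_injective _ hinj
  have hex : ∀ s : S, ∃ g : S[X], m g = spread K (algebraMap S K[X] s) := fun s ↦ by
    have := (Polynomial.lifts_iff_coeff_lifts
      (f := algebraMap S K[X]) (spread K (algebraMap S K[X] s))).mpr
      (fun j ↦ by
        rw [coeff_spread]
        exact hS s j)
    exact (Polynomial.mem_lifts _).mp this
  choose g hg using hex
  let ψ : S →+* S[X] :=
    { toFun := g
      map_one' := hm (by rw [hg, map_one, map_one, map_one])
      map_zero' := hm (by rw [hg, map_zero, map_zero, map_zero])
      map_mul' := fun x y ↦ hm (by rw [hg, map_mul m, hg, hg, map_mul, map_mul])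
      map_add' := fun x y ↦ hm (by rw [hg, map_add m, hg, hg, map_add, map_add]) }
  have key : IsIntegral S[X] (spread K f) :=
    hf.map_of_comp_eq ψ (spread K) (RingHom.ext hg)
  have := key.coeff i
  rwa [coeff_spread] at this

lemma monomial_coeff_mem_normalizedRees (a : IdealFiltration R) {f : K[X]}
    (hf : f ∈ a.normalizedRees K) (i : ℕ) : monomial i (f.coeff i) ∈ a.normalizedRees K :=
  isIntegral_monomial_coeff (S := a.reesInK K) Subtype.val_injective
    (fun s j ↦ ⟨⟨_, a.monomial_coeff_mem_reesInK K s.2 j⟩, rfl⟩) hf i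

/-- The degree `p` part of the normalized Rees algebra. -/
def normalizedReesPart (a : IdealFiltration R) (p : ℕ) : Submodule R (a.normalizedRees K) where
  carrier := {f | ∃ c : K, (f : K[X]) = monomial p c}
  add_mem' := by
    rintro f g ⟨c, hc⟩ ⟨d, hd⟩
    exact ⟨c + d, by simp [hc, hd]⟩
  zero_mem' := ⟨0, by simp⟩
  smul_mem' := by
    rintro r f ⟨c, hc⟩
    exact ⟨r • c, by rw [← smul_monomial, ← hc]; rfl⟩

lemma coeff_coe_directSum (a : IdealFiltration R)
    (x : DirectSum ℕ fun i ↦ a.normalizedReesPart K i) (i : ℕ) :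
    ((DirectSum.coeAddMonoidHom (a.normalizedReesPart K) x : a.normalizedRees K) :
      K[X]).coeff i = ((x i : a.normalizedRees K) : K[X]).coeff i := by
  induction x using DirectSum.induction_on with
  | zero => simp
  | add x y hx hy => simp [hx, hy]
  | of j y =>
    rw [DirectSum.coeAddMonoidHom_of]
    by_cases h : j = i
    · subst h; simp
    · obtain ⟨⟨f, hf⟩, c, rfl : f = monomial j c⟩ := y
      rw [DirectSum.of_eq_of_ne _ _ _ (Ne.symm h)]
      simp [coeff_monomial, h]

lemma normalizedReesPart_isInternal (a : IdealFiltration R) :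
    DirectSum.IsInternal (a.normalizedReesPart K) := by
  classical
  constructor
  · intro x y hxy
    ext i : 1
    have h := a.coeff_coe_directSum K x i
    rw [hxy, a.coeff_coe_directSum K y i] at h
    obtain ⟨c, hc⟩ := (x i).2
    obtain ⟨d, hd⟩ := (y i).2
    rw [hc, hd, coeff_monomial_same, coeff_monomial_same] at h
    apply Subtype.ext
    apply Subtype.ext
    rw [hc, hd, h]
  · intro f
    refine ⟨∑ i ∈ f.1.support, DirectSum.of (fun i ↦ a.normalizedReesPart K i) i
      ⟨⟨monomial i (f.1.coeff i), a.monomial_coeff_mem_normalizedRees K f.2 i⟩, _, rfl⟩, ?_⟩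
    apply Subtype.ext
    rw [map_sum]
    simp only [DirectSum.coeAddMonoidHom_of, AddSubmonoidClass.coe_finsetSum]
    exact f.1.as_sum_support.symm

instance (a : IdealFiltration R) : GradedAlgebra (a.normalizedReesPart K) where
  one_mem := ⟨1, rfl⟩
  mul_mem := by
    rintro i j f g ⟨c, hc⟩ ⟨d, hd⟩
    exact ⟨c * d, by simp [hc, hd, monomial_mul_monomial]⟩
  toDecomposition := (a.normalizedReesPart_isInternal K).chooseDecomposition

open AlgebraicGeometry CategoryTheory

/-- `Proj` of the normalized Rees algebra. -/
def normalizedProj (a : IdealFiltration R) : Scheme.{u} := Proj (a.normalizedReesPart K)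

/-- The structure morphism from `Proj` of the normalized Rees algebra to `Spec R`. -/
def normalizedProjMap (a : IdealFiltration R) : a.normalizedProj K ⟶ Spec (CommRingCat.of R) :=
  Proj.toSpecZero (a.normalizedReesPart K) ≫
    Spec.map (CommRingCat.ofHom (algebraMap R (a.normalizedReesPart K 0)))

/-- The pullback of functions from `R` to the local ring at a point `y`. -/
def toStalk (a : IdealFiltration R) (y : a.normalizedProj K) :
    R →+* (a.normalizedProj K).presheaf.stalk y :=
  ((Scheme.ΓSpecIso (CommRingCat.of R)).inv ≫ (a.normalizedProjMap K).appTop ≫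
    (a.normalizedProj K).presheaf.germ ⊤ y trivial).hom

/-- `v` is the divisorial valuation `ord_E` (restricted to `R`) of a prime divisor `E` on `Proj` of
the normalized Rees algebra.  The divisor is given by its generic point `y`, a point of codimension
one whose local ring is a discrete valuation ring, and `v(h)` is the order of the pullback of `h` in
that ring.  The last condition says that `v` extends to a valuation of `Frac R`. -/
def IsDivisorialValuation (a : IdealFiltration R) (v : AddValuation R ℕ∞) : Prop :=
  ∃ y : a.normalizedProj K, Order.coheight y = 1 ∧
    (∃ (_ : IsDomain ((a.normalizedProj K).presheaf.stalk y))
      (_ : IsDiscreteValuationRing ((a.normalizedProj K).presheaf.stalk y)),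
      ∀ h : R, v h = IsDiscreteValuationRing.addVal ((a.normalizedProj K).presheaf.stalk y)
        (a.toStalk K y h)) ∧
    ∀ h : R, v h = ⊤ → h = 0

end Proj

end IdealFiltration

end

/-! Up to integral closure, the `m`-th Veronese of the Rees algebra is the Rees algebra of a single
ideal. Take monomial generators `x T ^ d` of positive degree, let `m` be the product of the degrees
and `S ⊆ a_m` the set of the powers `x ^ (m / d)` (`exists_isReductionSet`). For nonzero `f ∈ S`,
the chart of `Proj` at `f T ^ m` is the integral closure in `K` of the blowup chart `A = R[g / f : g
∈ S]` (`awayEquiv`). By the valuative criterion, `x` is integral over `(S) ^ n` once `x / f ^ n` is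
integral over every such `A` (`mem_integralClosureSet_of_isIntegral_blowupChart`).

On one chart, non-integrality of `x / f ^ n` is witnessed by one of finitely many discrete valuation
rings, independent of `x` and `n`. Universal catenarity yields a height-one prime `q` of `A` at
which integrality already fails (`exists_height_one_prime_of_not_isIntegral`). Necessarily `f ∈ q`,
so `q` is minimal over `f`, and divisibility of `x` by `f ^ n` fails at some prime `P` of the
integral closure above `q` (`exists_mem_primesOverMinimalPrimes`). Krull–Akizuki, rather than
finiteness of the integral closure over `A`, shows that the local ring at `P` is a discrete
valuation ring and that only finitely many `P` lie over `q`.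

Let `V` be the set of all these orders. For `v ∈ V` coming from the chart at `f`, put `c = v(f) >
0`. If `y ∈ a_p`, then `y ^ m / f ^ p` is integral over the chart, so `m v(y) ≥ p c`, with equality
at `y = f`, `p = m`; hence `v(a) = c / m`. Conversely, `v(x) ≥ n c` for all `v ∈ V` puts `x` in the
integral closure of `a_{mn}`. The formula for the exponent is then arithmetic
(`lojasiewicz_eq_sup'`): containments bound `v(a) / v(b)` by testing on powers of elements, and a
strict inequality `v(a) / v(b) < q / p` leaves slack linear in `t`, which absorbs rounding `p t` up
to a multiple of `m`. -/

noncomputable section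

/-! ### A Krull–Akizuki theorem -/

section KrullAkizuki

variable {O S : Type*} [CommRing O] [CommRing S] [Algebra O S]

/-- The powers of `x` stabilize modulo `c`, so `x ^ k = x ^ (k + 1) * d - c * e`; multiplying by `s`
turns `c * s` into the element `b` of `O`. -/
lemma exists_pow_mul_mem_of_isArtinianRing_quotient (x c b : O)
    (hart : IsArtinianRing (O ⧸ Ideal.span {c})) (s : S)
    (hs : algebraMap O S c * s = algebraMap O S b) :
    ∃ (k : ℕ) (s' : S) (r : O),
      algebraMap O S x ^ k * s = algebraMap O S x ^ (k + 1) * s' + algebraMap O S r := by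
  obtain ⟨k, y, hy⟩ := IsArtinian.exists_pow_succ_smul_dvd (R := O ⧸ Ideal.span {c})
    (Ideal.Quotient.mk _ x) (1 : O ⧸ Ideal.span {c})
  obtain ⟨d, rfl⟩ := Ideal.Quotient.mk_surjective y
  have h1 : Ideal.Quotient.mk (Ideal.span {c}) (x ^ (k + 1) * d) =
      Ideal.Quotient.mk (Ideal.span {c}) (x ^ k) := by
    simpa using hy
  obtain ⟨e, he⟩ := Ideal.mem_span_singleton.mp (Ideal.Quotient.eq.mp h1)
  refine ⟨k, algebraMap O S d * s, - (e * b), ?_⟩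
  have he' := congrArg (algebraMap O S) he
  simp only [map_sub, map_mul, map_pow, map_neg] at he' ⊢
  linear_combination (-s) * he' - algebraMap O S e * hs

variable [IsDomain S]

/-- Makes the exponent of the previous lemma independent of `s`. The contractions of `X ^ n S` to
`O` have images in the Artinian ring `O / x` that are constant from some `n` on; above that `n` the
exponent can be lowered one step at a time. -/
lemma exists_uniform_pow_mul_mem (x : O) (hx : algebraMap O S x ≠ 0)
    (hart : ∀ c : O, algebraMap O S c ≠ 0 → IsArtinianRing (O ⧸ Ideal.span {c}))
    (hfrac : ∀ s : S, ∃ b c : O, algebraMap O S c ≠ 0 ∧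
      algebraMap O S c * s = algebraMap O S b) :
    ∃ n : ℕ, ∀ s : S, ∃ (s' : S) (r : O),
      algebraMap O S x ^ n * s = algebraMap O S x ^ (n + 1) * s' + algebraMap O S r := by
  have := hart x hx
  set X := algebraMap O S x with hX
  let I : ℕ → Ideal O := fun n ↦ (Ideal.span {X ^ n}).comap (algebraMap O S)
  have hI : Antitone I := fun m n h ↦ Ideal.comap_mono (by
    rw [Ideal.span_singleton_le_span_singleton]; exact pow_dvd_pow _ h)
  obtain ⟨n, hn⟩ := IsArtinian.monotone_stabilizes (R := O ⧸ Ideal.span {x})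
    (M := O ⧸ Ideal.span {x})
    ⟨fun n ↦ OrderDual.toDual ((I n).map (Ideal.Quotient.mk (Ideal.span {x}))),
      fun m n h ↦ Ideal.map_mono (hI h)⟩
  have hstep : ∀ k, n ≤ k → ∀ r ∈ I k, ∃ r' ∈ I (k + 1), ∃ d, r = r' + x * d := by
    intro k hk r hr
    have h1 : (I k).map (Ideal.Quotient.mk (Ideal.span {x})) =
        (I (k + 1)).map (Ideal.Quotient.mk (Ideal.span {x})) :=
      (hn k hk).symm.trans (hn (k + 1) (by omega))
    have h2 := Ideal.mem_map_of_mem (Ideal.Quotient.mk (Ideal.span {x})) hr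
    rw [h1, Ideal.mem_map_iff_of_surjective _ Ideal.Quotient.mk_surjective] at h2
    obtain ⟨r', hr', e⟩ := h2
    obtain ⟨d, hd⟩ := Ideal.mem_span_singleton.mp (Ideal.Quotient.eq.mp e.symm)
    exact ⟨r', hr', d, by rw [← hd]; ring⟩
  refine ⟨n, fun s ↦ ?_⟩
  have key : ∀ j, (∃ (s' : S) (r : O), X ^ (n + j) * s = X ^ (n + j + 1) * s' + algebraMap O S r) →
      ∃ (s' : S) (r : O), X ^ n * s = X ^ (n + 1) * s' + algebraMap O S r := by
    intro j
    induction j with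
    | zero => exact id
    | succ j ih =>
      rintro ⟨s', r, h⟩
      apply ih
      have hr : r ∈ I (n + j + 1) := by
        rw [Ideal.mem_comap, Ideal.mem_span_singleton]
        refine ⟨s - X * s', ?_⟩
        rw [← add_assoc] at h
        linear_combination -h
      -- Trading `r` for an element one power of `X` deeper plus a multiple of `x` makes every term
      -- divisible by `X`, which then cancels.
      obtain ⟨r', hr', d, rfl⟩ := hstep _ (by omega) r hr
      rw [Ideal.mem_comap, Ideal.mem_span_singleton] at hr'
      obtain ⟨s'', hs''⟩ := hr'
      refine ⟨s' + s'', d, mul_left_cancel₀ hx ?_⟩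
      rw [map_add, map_mul, ← hX, hs''] at h
      linear_combination h
  obtain ⟨b, c, hc, hs⟩ := hfrac s
  obtain ⟨k, s', r, h⟩ := exists_pow_mul_mem_of_isArtinianRing_quotient x c b (hart c hc) s hs
  refine key k ⟨X ^ 0 * s', x ^ n * r, ?_⟩
  rw [map_mul, map_pow, ← hX]
  linear_combination X ^ n * h

/-- Krull–Akizuki for birational extensions. -/
theorem isNoetherianRing_of_isArtinianRing_quotient [IsNoetherianRing O]
    (hart : ∀ c : O, algebraMap O S c ≠ 0 → IsArtinianRing (O ⧸ Ideal.span {c}))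
    (hfrac : ∀ s : S, ∃ b c : O, algebraMap O S c ≠ 0 ∧
      algebraMap O S c * s = algebraMap O S b) : IsNoetherianRing S := by
  classical
  refine (isNoetherianRing_iff_ideal_fg S).mpr fun J ↦ ?_
  by_cases hJ : J = ⊥
  · rw [hJ]; exact Submodule.fg_bot
  obtain ⟨j, hj, hj0⟩ := Submodule.exists_mem_ne_zero_of_ne_bot hJ
  obtain ⟨x, c, hc, hcj⟩ := hfrac j
  have hx : algebraMap O S x ≠ 0 := hcj ▸ mul_ne_zero hc hj0
  have hxJ : algebraMap O S x ∈ J := hcj ▸ J.mul_mem_left _ hj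
  obtain ⟨n, hn⟩ := exists_uniform_pow_mul_mem x hx hart hfrac
  set X := algebraMap O S x with hX
  -- This ideal of the Noetherian ring `O` records `X ^ n J` modulo `X ^ (n + 1) S`. Lifts to `J` of
  -- its finitely many generators, together with `X`, generate `J`, since `X ^ n S ⊆ X ^ (n + 1) S +
  -- O`.
  let I : Ideal O := (Ideal.span {X ^ n} * J ⊔ Ideal.span {X ^ (n + 1)}).comap (algebraMap O S)
  obtain ⟨T, hT⟩ := (isNoetherianRing_iff_ideal_fg O).mp inferInstance I
  have hmem : ∀ (J' : Ideal S) (y : S), y ∈ Ideal.span {X ^ n} * J' ⊔ Ideal.span {X ^ (n + 1)} ↔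
      ∃ j ∈ J', ∃ s, y = X ^ n * j + X ^ (n + 1) * s := by
    intro J' y
    rw [Submodule.mem_sup]
    constructor
    · rintro ⟨a, ha, b, hb, rfl⟩
      obtain ⟨j, hj, rfl⟩ := Ideal.mem_span_singleton_mul.mp ha
      obtain ⟨s, rfl⟩ := Ideal.mem_span_singleton.mp hb
      exact ⟨j, hj, s, rfl⟩
    · rintro ⟨j, hj, s, rfl⟩
      exact ⟨_, Ideal.mem_span_singleton_mul.mpr ⟨j, hj, rfl⟩, _,
        Ideal.mem_span_singleton.mpr ⟨s, rfl⟩, rfl⟩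
  have hT' : ∀ t ∈ T, ∃ j ∈ J, ∃ s, algebraMap O S t = X ^ n * j + X ^ (n + 1) * s := by
    intro t ht
    have : t ∈ I := hT ▸ Ideal.subset_span ht
    exact (hmem J _).mp this
  choose! g hgJ s hs using hT'
  let J' : Ideal S := Ideal.span (T.image g)
  have hIJ' : I ≤ (Ideal.span {X ^ n} * J' ⊔ Ideal.span {X ^ (n + 1)}).comap (algebraMap O S) := by
    rw [← hT, Ideal.span_le]
    intro t ht
    exact (hmem J' _).mpr ⟨g t, Ideal.subset_span (by simpa using ⟨t, ht, rfl⟩), s t, hs t ht⟩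
  refine ⟨insert X (T.image g), le_antisymm (Ideal.span_le.mpr ?_) fun j hj ↦ ?_⟩
  · intro y hy
    simp only [Finset.coe_insert, Finset.coe_image, Set.mem_insert_iff, Set.mem_image] at hy
    rcases hy with rfl | ⟨t, ht, rfl⟩
    · exact hxJ
    · exact hgJ t ht
  · obtain ⟨s', r, h⟩ := hn j
    have hr : r ∈ I := (hmem J _).mpr ⟨j, hj, -s', by linear_combination -h⟩
    obtain ⟨j', hj', s'', h'⟩ := (hmem J' _).mp (hIJ' hr)
    have : j = X * (s' + s'') + j' := by
      refine mul_left_cancel₀ (pow_ne_zero n hx) ?_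
      rw [h, h']; ring
    change j ∈ Ideal.span _
    rw [this, Finset.coe_insert, Ideal.span_insert]
    exact Submodule.add_mem_sup (Ideal.mem_span_singleton.mpr ⟨_, rfl⟩) hj'

end KrullAkizuki

/-! ### Catenarity and integral closures -/

section Catenary

/-- Descend from `q` through primes covered by the current one and containing `p`; the height drops
strictly, so the descent ends at `p`. -/
lemma exists_saturated_relSeries {A : Type*} [CommRing A] [IsNoetherianRing A]
    (p q : PrimeSpectrum A) (h : p ≤ q) :
    ∃ s : RelSeries {x : PrimeSpectrum A × PrimeSpectrum A | x.1 ⋖ x.2},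
      s.head = p ∧ s.last = q := by
  induction hn : q.asIdeal.height using WellFoundedLT.induction generalizing q with
  | ind n ih =>
    rcases h.eq_or_lt with rfl | hlt
    · exact ⟨RelSeries.singleton _ p, rfl, rfl⟩
    · obtain ⟨⟨x, hx⟩, hqx, hxp⟩ := @exists_le_covBy_of_lt { I : Ideal A // I.IsPrime }
        ⟨p.asIdeal, p.isPrime⟩ ⟨q.asIdeal, q.isPrime⟩ _ _ hlt
      have hxq : (⟨x, hx⟩ : PrimeSpectrum A) ⋖ q :=
        ⟨hxp.1, fun c hc hc' ↦ hxp.2 (c := ⟨c.asIdeal, c.isPrime⟩) hc hc'⟩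
      have hlt' : x < q.asIdeal := hxp.1
      obtain ⟨s, hs, hs'⟩ := ih x.height
        (hn ▸ Ideal.height_strict_mono_of_isPrime_of_isPrime hlt') ⟨x, hx⟩ hqx rfl
      exact ⟨s.snoc q (by rw [hs']; exact hxq), by simpa using hs, by simp⟩

/-- Refining the three strict inclusions gives a saturated chain of length at least 3 with the same
ends as one of length 2. -/
lemma IsCatenaryRing.false_of_lt {A : Type*} [CommRing A] [IsNoetherianRing A]
    (hA : IsCatenaryRing A) {p₀ p₁ p₂ q₁ q₂ : PrimeSpectrum A}
    (h₀₁ : p₀ ⋖ p₁) (h₁₂ : p₁ ⋖ p₂) (h₁ : p₀ < q₁) (h₂ : q₁ < q₂) (h₃ : q₂ < p₂) : False := by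
  have aux : ∀ {a b : PrimeSpectrum A}, a < b →
      ∃ s : RelSeries {x : PrimeSpectrum A × PrimeSpectrum A | x.1 ⋖ x.2},
        s.head = a ∧ s.last = b ∧ 1 ≤ s.length := fun {a b} hab ↦ by
    obtain ⟨s, hs, hs'⟩ := exists_saturated_relSeries a b hab.le
    refine ⟨s, hs, hs', Nat.one_le_iff_ne_zero.mpr fun h ↦ hab.ne ?_⟩
    rw [← hs, ← hs', RelSeries.head, RelSeries.last]
    congr 1
    ext
    simp [h]
  obtain ⟨s₁, a₁, b₁, c₁⟩ := aux h₁
  obtain ⟨s₂, a₂, b₂, c₂⟩ := aux h₂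
  obtain ⟨s₃, a₃, b₃, c₃⟩ := aux h₃
  let s := s₁.smash (s₂.smash s₃ (b₂.trans a₃.symm)) (by simp [a₂, b₁])
  let t : RelSeries {x : PrimeSpectrum A × PrimeSpectrum A | x.1 ⋖ x.2} :=
    { length := 2
      toFun := ![p₀, p₁, p₂]
      step := Fin.forall_fin_two.mpr ⟨h₀₁, h₁₂⟩ }
  have := hA s t (by rw [RelSeries.head_smash, a₁]; rfl)
    (by rw [RelSeries.last_smash, RelSeries.last_smash, b₃]; rfl)
  have ht : t.length = 2 := rfl
  rw [ht] at this
  simp only [s, RelSeries.smash_length] at this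
  omega

lemma IsCatenaryRing.of_ringEquiv {A B : Type*} [CommRing A] [CommRing B] (e : A ≃+* B)
    (hA : IsCatenaryRing A) : IsCatenaryRing B := by
  let φ : PrimeSpectrum B ≃o PrimeSpectrum A := PrimeSpectrum.comapEquiv e.symm
  let Φ : SetRel.Hom {x : PrimeSpectrum B × PrimeSpectrum B | x.1 ⋖ x.2}
      {x : PrimeSpectrum A × PrimeSpectrum A | x.1 ⋖ x.2} :=
    ⟨φ, fun h ↦ (apply_covBy_apply_iff φ).mpr h⟩
  intro s t h h'
  exact hA (s.map Φ) (t.map Φ) (by simp [h]) (by simp [h'])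

lemma IsUniversallyCatenaryRing.isCatenaryRing {R A : Type*} [CommRing R] [CommRing A]
    [Algebra R A] [Algebra.FiniteType R A] (hR : IsUniversallyCatenaryRing R) :
    IsCatenaryRing A := by
  obtain ⟨n, f, hf⟩ := Algebra.FiniteType.iff_quotient_mvPolynomial''.mp
    (inferInstance : Algebra.FiniteType R A)
  exact (hR n (RingHom.ker f)).of_ringEquiv (Ideal.quotientKerAlgEquivOfSurjective hf).toRingEquiv

lemma Ideal.false_of_lt_of_height_le_one {A : Type*} [CommRing A] [IsNoetherianRing A]
    {p₁ p₂ p : Ideal A} [p₁.IsPrime] [p₂.IsPrime] [p.IsPrime] (hp : p.height ≤ 1)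
    (h₁ : p₁ < p₂) (h₂ : p₂ < p) : False := by
  have h1 := Ideal.height_strict_mono_of_isPrime h₁
  have h2 := Ideal.height_strict_mono_of_isPrime h₂
  have h3 : p₂.height < 1 := h2.trans_le hp
  rw [Order.lt_one_iff] at h3
  simp [h3] at h1

variable {A K : Type*} [CommRing A] [Field K] [Algebra A K] [IsFractionRing A K]

/-- Since `p` meets `A` in zero, `K` embeds in the fraction field of `A[X] / p`. There the class of
`X` and the image of `w` both solve `d * X = c`, so they agree, and a polynomial killing `w` lies in
`p`. -/
lemma ker_aeval_le_of_mem {w : K} {c d : A} (hd : d ≠ 0)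
    (hw : algebraMap A K d * w = algebraMap A K c) {p : Ideal A[X]} [p.IsPrime]
    (hp : C d * X - C c ∈ p) (hpC : ∀ r : A, C r ∈ p → r = 0) :
    RingHom.ker (aeval (R := A) w) ≤ p := by
  let F := FractionRing (A[X] ⧸ p)
  let i : A →+* F := (algebraMap (A[X] ⧸ p) F).comp ((Ideal.Quotient.mk p).comp C)
  have hF : Function.Injective (algebraMap (A[X] ⧸ p) F) := IsFractionRing.injective _ _
  have hi : Function.Injective i := (injective_iff_map_eq_zero _).mpr fun r hr ↦
    hpC r (Ideal.Quotient.eq_zero_iff_mem.mp ((map_eq_zero_iff _ hF).mp hr))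
  let j : K →+* F := IsFractionRing.lift hi
  have hj : ∀ r, j (algebraMap A K r) = i r := IsFractionRing.lift_algebraMap hi
  have hx : j w = algebraMap _ F (Ideal.Quotient.mk p X) := by
    have h1 := congrArg j hw
    rw [map_mul, hj, hj] at h1
    have h2 := congrArg (algebraMap _ F) (Ideal.Quotient.eq_zero_iff_mem.mpr hp)
    rw [map_sub, map_sub, map_mul, map_mul, map_zero, sub_eq_zero] at h2
    exact mul_left_cancel₀ ((map_ne_zero_iff i hi).mpr hd) (h1.trans h2.symm)
  intro g hg
  rw [RingHom.mem_ker] at hg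
  rw [← Ideal.Quotient.eq_zero_iff_mem, ← map_eq_zero_iff _ hF]
  have h1 : (algebraMap (A[X] ⧸ p) F).comp (Ideal.Quotient.mk p) =
      j.comp (aeval (R := A) w : A[X] →ₐ[A] K).toRingHom := by
    ext r
    · simpa [i] using (hj r).symm
    · simpa using hx.symm
  have h2 := congrArg (fun φ : A[X] →+* F ↦ φ g) h1
  simp only [RingHom.comp_apply] at h2
  rw [h2]
  simpa using hg

/-- If `z` is not integral over `A`, it is not integral over some `A_q` with `q` of height one. -/
theorem exists_height_one_prime_of_not_isIntegral [IsDomain A] [IsNoetherianRing A]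
    (hcat : IsCatenaryRing A[X]) {z : K} (hz : ¬ IsIntegral A z) :
    ∃ q : Ideal A, q.IsPrime ∧ q ≠ ⊥ ∧ (∀ q₁ : Ideal A, q₁.IsPrime → q₁ < q → q₁ = ⊥) ∧
      ∀ s ∉ q, ¬ IsIntegral A (algebraMap A K s * z) := by
  have hz0 : z ≠ 0 := by rintro rfl; exact hz isIntegral_zero
  have hinj : Function.Injective (algebraMap A K) := IsFractionRing.injective _ _
  let w : K := z⁻¹
  have hw0 : w ≠ 0 := inv_ne_zero hz0
  let _ : Invertible z := invertibleOfNonzero hz0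
  have hwz : ⅟z = w := invOf_eq_inv z
  have hrev : ∀ g : A[X], aeval w g = 0 ↔ aeval z g.reverse = 0 := fun g ↦ by
    let _ : Invertible w := invertibleOfNonzero hw0
    have := eval₂_reverse_eq_zero_iff (algebraMap A K) w g
    rw [invOf_eq_inv, inv_inv] at this
    exact this.symm
  have hrev' : ∀ g : A[X], aeval z g = 0 ↔ aeval w g.reverse = 0 := fun g ↦ by
    have := eval₂_reverse_eq_zero_iff (algebraMap A K) z g
    rw [invOf_eq_inv] at this
    exact this.symm
  obtain ⟨c, d, hd, hcd⟩ := IsFractionRing.div_surjective (A := A) w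
  have hd0 : d ≠ 0 := nonZeroDivisors.ne_zero hd
  have hdw : algebraMap A K d * w = algebraMap A K c := by
    rw [← hcd, mul_div_cancel₀]
    exact (map_ne_zero_iff _ hinj).mpr hd0
  have hc0 : c ≠ 0 := by
    rintro rfl
    rw [map_zero, mul_eq_zero] at hdw
    exact hdw.elim ((map_ne_zero_iff _ hinj).mpr hd0) hw0
  -- `A[X] / P₀` is `A[w]` with `w = z⁻¹`. With `Q` minimal over `P₀ + (X)`, Krull's principal ideal
  -- theorem, applied to `d * X - c` and then to `X` modulo `P₀`, makes `⊥ ⋖ P₀ ⋖ Q` saturated. The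
  -- required prime is `Q ∩ A`.
  let P₀ : Ideal A[X] := RingHom.ker (aeval (R := A) w)
  have hP₀ : P₀.IsPrime := RingHom.ker_isPrime _
  have hP₀C : ∀ r : A, C r ∈ P₀ → r = 0 := fun r hr ↦ by
    rw [RingHom.mem_ker, aeval_C] at hr
    exact (map_eq_zero_iff _ hinj).mp hr
  have hdX : C d * X - C c ∈ P₀ := by
    rw [RingHom.mem_ker]; simp [hdw]
  have hP₀min : P₀ ∈ (Ideal.span {C d * X - C c}).minimalPrimes := by
    refine ⟨⟨hP₀, (Ideal.span_singleton_le_iff_mem _).mpr hdX⟩, fun p hp hpP ↦ ?_⟩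
    have := hp.1
    exact ker_aeval_le_of_mem hd0 hdw ((Ideal.span_singleton_le_iff_mem _).mp hp.2)
      fun r hr ↦ hP₀C r (hpP hr)
  have hP₀ht := Ideal.height_le_one_of_isPrincipal_of_mem_minimalPrimes _ _ hP₀min
  -- `w` is not a unit of `A[w]`: a relation `1 = w * h(w)` reverses to a monic equation for `z`.
  have hne : P₀ ⊔ Ideal.span {X} ≠ ⊤ := by
    intro h
    obtain ⟨g, hg, y, hy, hgy⟩ := Submodule.mem_sup.mp ((Ideal.eq_top_iff_one _).mp h)
    obtain ⟨h, rfl⟩ := Ideal.mem_span_singleton.mp hy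
    have hg' : (1 - X * h : A[X]) ∈ P₀ := by rwa [← hgy, add_sub_cancel_right]
    refine hz ⟨(1 - X * h).reverse, ?_, by simpa [aeval_def] using (hrev _).mp hg'⟩
    rw [Monic, reverse_leadingCoeff, trailingCoeff,
      natTrailingDegree_eq_zero.mpr (Or.inr (by simp))]
    simp
  obtain ⟨Q, hQ⟩ := Ideal.nonempty_minimalPrimes hne
  have hQp : Q.IsPrime := hQ.1.1
  have hP₀Q : P₀ ≤ Q := le_sup_left.trans hQ.1.2
  have hXQ : X ∈ Q := hQ.1.2 (Ideal.mem_sup_right (Ideal.mem_span_singleton_self X))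
  have hXP₀ : X ∉ P₀ := by rw [RingHom.mem_ker, aeval_X]; exact hw0
  have hcov₁ : (⊥ : PrimeSpectrum A[X]) ⋖ ⟨P₀, hP₀⟩ := by
    refine ⟨?_, fun p hp hp' ↦ ?_⟩
    · refine bot_lt_iff_ne_bot.mpr fun h ↦ ?_
      have : P₀ = ⊥ := congrArg PrimeSpectrum.asIdeal h
      rw [this] at hdX
      have := congrArg (fun g : A[X] ↦ g.coeff 1) (Ideal.mem_bot.mp hdX)
      simp [coeff_C] at this
      exact hd0 this
    · exact Ideal.false_of_lt_of_height_le_one (p₁ := (⊥ : PrimeSpectrum A[X]).asIdeal)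
        (p₂ := p.asIdeal) hP₀ht hp hp'
  have hcov₂ : (⟨P₀, hP₀⟩ : PrimeSpectrum A[X]) ⋖ ⟨Q, hQp⟩ := by
    refine ⟨lt_of_le_not_ge hP₀Q fun h ↦ hXP₀ (h hXQ), fun p hp hp' ↦ ?_⟩
    have hht := Ideal.map_height_le_one_of_mem_minimalPrimes hQ
    have hsurj : Function.Surjective (Ideal.Quotient.mk P₀) := Ideal.Quotient.mk_surjective
    have hcm : ∀ I : Ideal A[X], P₀ ≤ I →
        (I.map (Ideal.Quotient.mk P₀)).comap (Ideal.Quotient.mk P₀) = I := fun I hI ↦ by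
      rw [Ideal.comap_map_of_surjective _ hsurj, ← RingHom.ker_eq_comap_bot, Ideal.mk_ker,
        sup_eq_left.mpr hI]
    have hlt : ∀ I J : Ideal A[X], P₀ ≤ I → I < J →
        I.map (Ideal.Quotient.mk P₀) < J.map (Ideal.Quotient.mk P₀) := fun I J hI hIJ ↦ by
      refine lt_of_le_of_ne (Ideal.map_mono hIJ.le) fun h ↦ hIJ.ne ?_
      rw [← hcm I hI, h, hcm J (hI.trans hIJ.le)]
    have hp0 : P₀ < p.asIdeal := hp
    have hpQ : p.asIdeal < Q := hp'
    have := Ideal.map_isPrime_of_surjective hsurj (I := Q) (by rwa [Ideal.mk_ker])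
    have := Ideal.map_isPrime_of_surjective hsurj (I := p.asIdeal) (by rw [Ideal.mk_ker]; exact hp0.le)
    have := Ideal.map_isPrime_of_surjective hsurj (I := P₀) (by rw [Ideal.mk_ker])
    exact Ideal.false_of_lt_of_height_le_one hht (hlt _ _ le_rfl hp0) (hlt _ _ hp0.le hpQ)
  let q : Ideal A := Q.comap C
  have hcq : c ∈ q := by
    have h1 := Q.sub_mem (Q.mul_mem_left (C d) hXQ) (hP₀Q hdX)
    rwa [sub_sub_cancel] at h1
  refine ⟨q, inferInstance, fun h ↦ hc0 (by rwa [h] at hcq), fun q₁ hq₁ hlt ↦ ?_, fun s hs hi ↦ ?_⟩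
  · by_contra hne
    have hmC : ∀ (I J : Ideal A), I < J → I.map C < J.map C := fun I J hIJ ↦ by
      refine lt_of_le_not_ge (Ideal.map_mono hIJ.le) fun h ↦ hIJ.not_ge fun r hr ↦ ?_
      have := Ideal.mem_map_C_iff.mp (h (Ideal.mem_map_of_mem C hr)) 0
      simpa using this
    have hpr : ∀ I : Ideal A, I.IsPrime → (I.map (C : A →+* A[X])).IsPrime :=
      fun I _ ↦ Ideal.isPrime_map_C_of_isPrime
    -- The competing chain is `⊥ < q₁[X] < q[X] < Q`, the last step being strict because `X ∈ Q`.
    refine hcat.false_of_lt hcov₁ hcov₂ (q₁ := ⟨q₁.map C, hpr _ hq₁⟩)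
      (q₂ := ⟨q.map C, hpr _ inferInstance⟩) ?_ (hmC _ _ hlt) ?_
    · have := hmC ⊥ q₁ (bot_lt_iff_ne_bot.mpr hne)
      rw [Ideal.map_bot] at this
      exact this
    · refine lt_of_le_not_ge (Ideal.map_comap_le : q.map C ≤ Q) fun h ↦ ?_
      have := Ideal.mem_map_C_iff.mp (h hXQ) 1
      rw [coeff_X_one] at this
      exact (inferInstance : q.IsPrime).ne_top ((Ideal.eq_top_iff_one _).mpr this)
  · obtain ⟨p, hp, hpz⟩ := hi
    have hs0 : s ≠ 0 := fun h ↦ hs (h ▸ q.zero_mem)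
    -- `g` kills `z` and has leading coefficient a power of `s`. Its reversal lies in `P₀ ⊆ Q` and
    -- has that power as constant term, so `X ∈ Q` forces `s ∈ q`.
    let g : A[X] := p.comp (C s * X)
    have hg : aeval z g = 0 := by
      rw [aeval_comp]
      simpa [aeval_def] using hpz
    have hlead : g.leadingCoeff = s ^ p.natDegree := by
      rw [leadingCoeff_comp (by rw [natDegree_C_mul_X _ hs0]; exact one_ne_zero), hp.leadingCoeff]
      simp
    have h1 : g.reverse ∈ Q := hP₀Q ((hrev' g).mp hg)
    have h2 : C (g.reverse.coeff 0) ∈ Q := by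
      have := Q.sub_mem h1 (Q.mul_mem_right g.reverse.divX hXQ)
      have h3 := divX_mul_X_add g.reverse
      rwa [sub_eq_iff_eq_add'.mpr (by rw [mul_comm]; exact h3.symm)] at this
    rw [coeff_zero_reverse, hlead] at h2
    exact hs ((inferInstance : q.IsPrime).mem_of_pow_mem _ h2)

end Catenary

/-! ### Discrete valuation rings over primes of height one -/

/-- A nonzero prime ideal of a domain with no smaller nonzero prime. -/
structure Ideal.IsMinimalNonzeroPrime {A : Type*} [CommRing A] (q : Ideal A) : Prop where
  isPrime : q.IsPrime
  ne_bot : q ≠ ⊥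
  eq_bot_of_lt : ∀ q₁ : Ideal A, q₁.IsPrime → q₁ < q → q₁ = ⊥

namespace Ideal.IsMinimalNonzeroPrime

variable {A : Type*} [CommRing A] [IsDomain A] {q : Ideal A} (hq : q.IsMinimalNonzeroPrime)

include hq

omit [IsDomain A] in
lemma eq_of_le {p : Ideal A} (hp : p.IsPrime) (hp0 : p ≠ ⊥) (h : p ≤ q) : p = q := by
  by_contra hne
  exact hp0 (hq.eq_bot_of_lt p hp (lt_of_le_of_ne h hne))

omit [IsDomain A] in
-- If `c` is not a unit, the maximal ideal of `A_q` is the only prime containing it, because nonzero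
-- primes of `A_q` contract to `q`.
lemma isArtinianRing_quotient [IsNoetherianRing A] [q.IsPrime] {c : Localization.AtPrime q}
    (hc : c ≠ 0) :
    IsArtinianRing (Localization.AtPrime q ⧸ Ideal.span {c}) := by
  by_cases hu : IsUnit c
  · have : Subsingleton (Localization.AtPrime q ⧸ Ideal.span {c}) :=
      Ideal.Quotient.subsingleton_iff.mpr (Ideal.span_singleton_eq_top.mpr hu)
    infer_instance
  refine IsLocalRing.quotient_artinian_of_mem_minimalPrimes_of_isLocalRing _
    ⟨⟨inferInstance, (Ideal.span_singleton_le_iff_mem _).mpr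
      ((IsLocalRing.mem_maximalIdeal c).mpr hu)⟩, ?_⟩
  rintro p ⟨hp, hcp⟩ -
  have hp0 : p ≠ ⊥ := by
    rintro rfl
    exact hc ((Ideal.span_singleton_le_iff_mem _).mp hcp)
  have hmc : (p.comap (algebraMap A (Localization.AtPrime q))).map
      (algebraMap A (Localization.AtPrime q)) = p :=
    IsLocalization.map_under q.primeCompl (Localization.AtPrime q) p
  have hcm : (IsLocalRing.maximalIdeal (Localization.AtPrime q)).comap
      (algebraMap A (Localization.AtPrime q)) = q := Localization.AtPrime.under_maximalIdeal
  have hle : p.comap (algebraMap A (Localization.AtPrime q)) ≤ q :=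
    (Ideal.comap_mono (IsLocalRing.le_maximalIdeal hp.ne_top)).trans_eq hcm
  have := hq.eq_of_le (hp.comap _) (fun h ↦ hp0 (by rw [← hmc, h, Ideal.map_bot])) hle
  rw [← hmc, this, Localization.AtPrime.map_eq_maximalIdeal]

omit [IsDomain A] in
-- Krull–Akizuki with `O = A_q`, which maps to `S` because `A ∖ q` becomes invertible there.
lemma isNoetherianRing [IsNoetherianRing A] {S : Type*} [CommRing S] [IsDomain S] [Algebra A S]
    (hinj : Function.Injective (algebraMap A S))
    (hunit : ∀ s ∉ q, IsUnit (algebraMap A S s))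
    (hfrac : ∀ s : S, ∃ b c : A, c ≠ 0 ∧ algebraMap A S c * s = algebraMap A S b) :
    IsNoetherianRing S := by
  have := hq.isPrime
  let φ : Localization.AtPrime q →+* S :=
    IsLocalization.lift (M := q.primeCompl) (g := algebraMap A S) fun s ↦ hunit s s.2
  have hφ : ∀ r, φ (algebraMap A _ r) = algebraMap A S r := IsLocalization.lift_eq _
  let _ : Algebra (Localization.AtPrime q) S := φ.toAlgebra
  refine isNoetherianRing_of_isArtinianRing_quotient (O := Localization.AtPrime q)
    (fun c hc ↦ hq.isArtinianRing_quotient fun h ↦ hc (by rw [h, map_zero])) fun s ↦ ?_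
  obtain ⟨b, c, hc, h⟩ := hfrac s
  refine ⟨algebraMap A _ b, algebraMap A _ c, ?_, ?_⟩
  · rw [RingHom.algebraMap_toAlgebra, hφ]
    exact (map_ne_zero_iff _ hinj).mpr hc
  · rw [RingHom.algebraMap_toAlgebra, hφ, hφ, h]

variable {N : Type*} [CommRing N] [IsDomain N] [Algebra A N] [Algebra.IsIntegral A N]
  (hinj : Function.Injective (algebraMap A N))

include hinj

omit hinj in
-- Incomparability: a strict inclusion would contract to a prime strictly below `q`, that is to
-- zero, and only zero lies over zero.
lemma eq_of_le_of_comap_eq {P P' : Ideal N} [P'.IsPrime] [P.IsPrime]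
    (hP : P.comap (algebraMap A N) = q) (h : P' ≤ P) (h0 : P' ≠ ⊥) : P' = P := by
  by_contra hne
  have h1 := Ideal.IsIntegral.comap_lt_comap (R := A) (lt_of_le_of_ne h hne)
  rw [hP] at h1
  exact h0 (Ideal.eq_bot_of_comap_eq_bot (hq.eq_bot_of_lt _ (Ideal.comap_isPrime _ _) h1))

variable [IsNoetherianRing A]
  (hfrac : ∀ s : N, ∃ b c : A, c ≠ 0 ∧ algebraMap A N c * s = algebraMap A N b)

include hfrac

omit [Algebra.IsIntegral A N] in
lemma isNoetherianRing_localization (M : Submonoid N) (hM0 : M ≤ nonZeroDivisors N)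
    (hM : ∀ s ∉ q, algebraMap A N s ∈ M) : IsNoetherianRing (Localization M) := by
  have : IsDomain (Localization M) := IsLocalization.isDomain_localization hM0
  have hNi : Function.Injective (algebraMap N (Localization M)) := IsLocalization.injective _ hM0
  have hcomp : ∀ r, algebraMap A (Localization M) r = algebraMap N _ (algebraMap A N r) :=
    fun r ↦ IsScalarTower.algebraMap_apply A N (Localization M) r
  refine hq.isNoetherianRing (S := Localization M) ?_ ?_ ?_
  · intro a b hab
    rw [hcomp, hcomp] at hab
    exact hinj (hNi hab)
  · intro s hs
    rw [hcomp]
    exact IsLocalization.map_units (Localization M) (⟨_, hM s hs⟩ : M)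
  · intro s
    obtain ⟨⟨x, y⟩, hxy⟩ := IsLocalization.surj M s
    obtain ⟨b, c, hc, h⟩ := hfrac x
    obtain ⟨b', c', hc', h'⟩ := hfrac y
    have hb' : b' ≠ 0 := by
      rintro rfl
      rw [map_zero, mul_eq_zero] at h'
      exact h'.elim ((map_ne_zero_iff _ hinj).mpr hc') (nonZeroDivisors.ne_zero (hM0 y.2))
    refine ⟨c' * b, c * b', mul_ne_zero hc hb', ?_⟩
    have h1 := congrArg (algebraMap N (Localization M)) h
    have h2 := congrArg (algebraMap N (Localization M)) h'
    simp only [map_mul, ← hcomp] at h1 h2 hxy ⊢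
    rw [← h1, ← h2, ← hxy]
    ring

/-- `N_P` is Noetherian by Krull–Akizuki, integrally closed, and has a unique nonzero prime by
incomparability. -/
theorem isDiscreteValuationRing_localization [IsIntegrallyClosed N] (P : Ideal N) [P.IsPrime]
    (hP : P.comap (algebraMap A N) = q) :
    IsDiscreteValuationRing (Localization.AtPrime P) := by
  have hM0 : P.primeCompl ≤ nonZeroDivisors N := P.primeCompl_le_nonZeroDivisors
  have : IsNoetherianRing (Localization.AtPrime P) :=
    hq.isNoetherianRing_localization hinj hfrac P.primeCompl hM0 fun s hs h ↦ hs (by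
      rw [← hP]; exact h)
  have : IsIntegrallyClosed (Localization.AtPrime P) :=
    isIntegrallyClosed_of_isLocalization _ P.primeCompl hM0
  have hmap : IsLocalRing.maximalIdeal (Localization.AtPrime P) ≠ ⊥ := by
    intro h
    have h1 : (IsLocalRing.maximalIdeal (Localization.AtPrime P)).comap
        (algebraMap N (Localization.AtPrime P)) = P := Localization.AtPrime.under_maximalIdeal
    rw [h, ← RingHom.ker_eq_comap_bot,
      (RingHom.injective_iff_ker_eq_bot _).mp (IsLocalization.injective _ hM0)] at h1
    apply hq.ne_bot
    rw [← hP, ← h1, ← RingHom.ker_eq_comap_bot, (RingHom.injective_iff_ker_eq_bot _).mp hinj]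
  have key := (IsDiscreteValuationRing.TFAE (Localization.AtPrime P)
    (IsLocalRing.isField_iff_maximalIdeal_eq.not.mpr hmap)).out 0 3
  refine key.mpr ⟨inferInstance, _, ⟨hmap, inferInstance⟩, ?_⟩
  rintro p ⟨hp0, hp⟩
  have hmc : (p.comap (algebraMap N (Localization.AtPrime P))).map
      (algebraMap N (Localization.AtPrime P)) = p :=
    IsLocalization.map_under P.primeCompl (Localization.AtPrime P) p
  have hcm : (IsLocalRing.maximalIdeal (Localization.AtPrime P)).comap
      (algebraMap N (Localization.AtPrime P)) = P := Localization.AtPrime.under_maximalIdeal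
  have hle : p.comap (algebraMap N (Localization.AtPrime P)) ≤ P :=
    (Ideal.comap_mono (IsLocalRing.le_maximalIdeal hp.ne_top)).trans_eq hcm
  have := hq.eq_of_le_of_comap_eq hP hle fun h ↦ hp0 (by rw [← hmc, h, Ideal.map_bot])
  rw [← hmc, this, Localization.AtPrime.map_eq_maximalIdeal]

/-- Inverting `A ∖ q` makes `N` Noetherian, and the primes over `q` become minimal primes of any
nonzero `x ∈ q`. -/
theorem finite_setOf_comap_eq :
    {P : Ideal N | P.IsPrime ∧ P.comap (algebraMap A N) = q}.Finite := by
  have hqp := hq.isPrime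
  let M : Submonoid N := Algebra.algebraMapSubmonoid N q.primeCompl
  have hM0 : M ≤ nonZeroDivisors N := by
    refine le_nonZeroDivisors_of_noZeroDivisors ?_
    rintro ⟨s, hs, h⟩
    exact hs ((map_eq_zero_iff _ hinj).mp h ▸ q.zero_mem)
  have := hq.isNoetherianRing_localization hinj hfrac M hM0 fun s hs ↦ ⟨s, hs, rfl⟩
  obtain ⟨x, hxq, hx0⟩ := Submodule.exists_mem_ne_zero_of_ne_bot hq.ne_bot
  let φ := algebraMap N (Localization M)
  have hdisj : ∀ P : Ideal N, P.comap (algebraMap A N) = q → Disjoint (M : Set N) P := by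
    rintro P hP
    rw [Set.disjoint_left]
    rintro _ ⟨s, hs, rfl⟩ h
    exact hs (hP ▸ h)
  refine Set.Finite.of_finite_image (f := Ideal.map φ) ((Ideal.finite_minimalPrimes_of_isNoetherianRing
    (Localization M) (Ideal.span {φ (algebraMap A N x)})).subset ?_) ?_
  · rintro _ ⟨P, ⟨hPp, hP⟩, rfl⟩
    have hxP : algebraMap A N x ∈ P := by rw [← hP] at hxq; exact hxq
    refine ⟨⟨IsLocalization.isPrime_of_isPrime_disjoint M _ P hPp (hdisj P hP),
      (Ideal.span_singleton_le_iff_mem _).mpr (Ideal.mem_map_of_mem _ hxP)⟩, ?_⟩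
    rintro p ⟨hp, hxp⟩ hpP
    have hle : p.comap φ ≤ P := by
      rw [← IsLocalization.under_map_of_isPrime_disjoint M (Localization M) hPp (hdisj P hP)]
      exact Ideal.comap_mono hpP
    rw [← hq.eq_of_le_of_comap_eq hP hle fun h ↦ ?_]
    · exact Ideal.map_comap_le
    · have : φ (algebraMap A N x) ∈ p := (Ideal.span_singleton_le_iff_mem _).mp hxp
      rw [← Ideal.mem_comap] at this
      rw [h, Ideal.mem_bot, map_eq_zero_iff _ hinj] at this
      exact hx0 this
  · rintro P ⟨hPp, hP⟩ P' ⟨hPp', hP'⟩ h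
    rw [← IsLocalization.under_map_of_isPrime_disjoint M (Localization M) hPp (hdisj P hP),
      ← IsLocalization.under_map_of_isPrime_disjoint M (Localization M) hPp' (hdisj P' hP')]
    exact congrArg (Ideal.comap φ) h

end Ideal.IsMinimalNonzeroPrime

/-! ### Primes of the integral closure over the minimal primes of an element -/

section IntegralClosure

variable {A K : Type*} [CommRing A] [IsDomain A] [IsNoetherianRing A] [Field K] [Algebra A K]
  [IsFractionRing A K]

omit [IsDomain A] [IsNoetherianRing A] [IsFractionRing A K] in
lemma algebraMap_integralClosure_injective (hinj : Function.Injective (algebraMap A K)) :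
    Function.Injective (algebraMap A (integralClosure A K)) := fun _ _ hab ↦
  hinj (congrArg (algebraMap (integralClosure A K) K) hab)

omit [IsNoetherianRing A] in
variable (A) in
lemma exists_mul_eq_algebraMap_integralClosure (s : integralClosure A K) :
    ∃ b c : A, c ≠ 0 ∧
      algebraMap A (integralClosure A K) c * s = algebraMap A (integralClosure A K) b := by
  obtain ⟨b, c, hc, h⟩ := IsFractionRing.div_surjective (A := A) (s : K)
  have hc0 : algebraMap A K c ≠ 0 :=
    (map_ne_zero_iff _ (IsFractionRing.injective A K)).mpr (nonZeroDivisors.ne_zero hc)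
  refine ⟨b, c, nonZeroDivisors.ne_zero hc, Subtype.ext ?_⟩
  change algebraMap A K c * (s : K) = algebraMap A K b
  rw [← h, mul_div_cancel₀ _ hc0]

lemma isMinimalNonzeroPrime_of_mem_minimalPrimes {f : A} (hf : f ≠ 0) {q : Ideal A}
    (hq : q ∈ (Ideal.span {f}).minimalPrimes) : q.IsMinimalNonzeroPrime := by
  have hqp := hq.isPrime
  refine ⟨hqp, ?_, fun q₁ h₁ hlt ↦ ?_⟩
  · rintro rfl
    exact hf ((Ideal.span_singleton_le_iff_mem _).mp hq.1.2)
  · by_contra hne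
    exact Ideal.false_of_lt_of_height_le_one (p₁ := ⊥)
      (Ideal.height_le_one_of_isPrincipal_of_mem_minimalPrimes _ _ hq)
      (bot_lt_iff_ne_bot.mpr hne) hlt

variable (K) in
/-- The primes of the integral closure of `A` in `K` that lie over the minimal primes of `f`. -/
def primesOverMinimalPrimes (f : A) : Set (Ideal (integralClosure A K)) :=
  {P | P.IsPrime ∧ P.comap (algebraMap A (integralClosure A K)) ∈ (Ideal.span {f}).minimalPrimes}

lemma finite_primesOverMinimalPrimes {f : A} (hf : f ≠ 0) :
    (primesOverMinimalPrimes K f).Finite := by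
  have : primesOverMinimalPrimes K f = ⋃ q ∈ (Ideal.span {f}).minimalPrimes,
      {P | P.IsPrime ∧ P.comap (algebraMap A (integralClosure A K)) = q} := by
    ext P
    simp only [primesOverMinimalPrimes, Set.mem_ofPred_eq, Set.mem_iUnion, exists_prop]
    exact ⟨fun h ↦ ⟨_, h.2, h.1, rfl⟩, fun ⟨q, hq, h, h'⟩ ↦ ⟨h, h' ▸ hq⟩⟩
  rw [this]
  exact (Ideal.finite_minimalPrimes_of_isNoetherianRing A _).biUnion fun q hq ↦
    (isMinimalNonzeroPrime_of_mem_minimalPrimes hf hq).finite_setOf_comap_eq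
      (algebraMap_integralClosure_injective (IsFractionRing.injective A K))
      (exists_mul_eq_algebraMap_integralClosure A)

omit [IsNoetherianRing A] in
variable (A K) in
lemma isIntegrallyClosed_integralClosure : IsIntegrallyClosed (integralClosure A K) := by
  have : Algebra.IsAlgebraic A K := IsLocalization.isAlgebraic K (nonZeroDivisors A)
  have : IsFractionRing (integralClosure A K) K :=
    integralClosure.isFractionRing_of_algebraic (A := A) (L := K)
      (fun x hx ↦ by simpa using hx)
  exact integralClosure.isIntegrallyClosedOfFiniteExtension K

theorem isDiscreteValuationRing_of_mem_primesOverMinimalPrimes {f : A} (hf : f ≠ 0)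
    {P : Ideal (integralClosure A K)} [P.IsPrime] (hP : P ∈ primesOverMinimalPrimes K f) :
    IsDiscreteValuationRing (Localization.AtPrime P) := by
  have := isIntegrallyClosed_integralClosure A K
  exact (isMinimalNonzeroPrime_of_mem_minimalPrimes hf hP.2).isDiscreteValuationRing_localization
    (algebraMap_integralClosure_injective (IsFractionRing.injective A K))
    (exists_mul_eq_algebraMap_integralClosure A) P rfl

theorem exists_mem_primesOverMinimalPrimes (hcat : IsCatenaryRing A[X]) {x f : A} (hf : f ≠ 0)
    {n : ℕ} (hx : ¬ IsIntegral A (algebraMap A K x / algebraMap A K f ^ n)) :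
    ∃ P : Ideal (integralClosure A K), ∃ _ : P.IsPrime, P ∈ primesOverMinimalPrimes K f ∧
      ¬ algebraMap A (Localization.AtPrime P) f ^ n ∣ algebraMap A (Localization.AtPrime P) x := by
  obtain ⟨q, hqp, hq0, hq1, hqz⟩ := exists_height_one_prime_of_not_isIntegral hcat hx
  have hq : q.IsMinimalNonzeroPrime := ⟨hqp, hq0, hq1⟩
  have hinj := IsFractionRing.injective A K
  have hfK : algebraMap A K f ^ n ≠ 0 := pow_ne_zero _ ((map_ne_zero_iff _ hinj).mpr hf)
  set z := algebraMap A K x / algebraMap A K f ^ n with hz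
  have hfz : algebraMap A K (f ^ n) * z = algebraMap A K x := by
    rw [map_pow, hz, mul_div_cancel₀ _ hfK]
  have hfq : f ∈ q := by
    by_contra hfq
    refine hqz (f ^ n) (fun h ↦ hfq (hqp.mem_of_pow_mem _ h)) ?_
    rw [hfz]
    exact isIntegral_algebraMap
  -- The denominators of `z` in the integral closure. `J` avoids `A ∖ q`, so it lies in a prime `P`
  -- that also avoids it; as `f ^ n ∈ J`, this `P` contracts to a nonzero prime inside `q`, hence to
  -- `q`. Divisibility at `P` would give a denominator outside `P`.
  let J : Ideal (integralClosure A K) :=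
    { carrier := {c | IsIntegral A ((c : K) * z)}
      add_mem' := fun ha hb ↦ by
        simp only [Set.mem_ofPred_eq, AddMemClass.coe_add, add_mul] at *
        exact ha.add hb
      zero_mem' := by simpa using isIntegral_zero
      smul_mem' := fun c a ha ↦ by
        simp only [Set.mem_ofPred_eq, smul_eq_mul, MulMemClass.coe_mul, mul_assoc] at *
        exact IsIntegral.mul c.2 ha }
  have hdisj : Disjoint (J : Set (integralClosure A K))
      (Algebra.algebraMapSubmonoid (integralClosure A K) q.primeCompl) := by
    rw [Set.disjoint_left]
    rintro _ hJ ⟨s, hs, rfl⟩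
    exact hqz s hs hJ
  obtain ⟨P, hP, hJP, hPq⟩ := Ideal.exists_le_prime_disjoint J _ hdisj
  have hle : P.comap (algebraMap A (integralClosure A K)) ≤ q := fun s hs ↦ by
    by_contra hsq
    exact Set.disjoint_left.mp hPq hs ⟨s, hsq, rfl⟩
  have hfP : algebraMap A (integralClosure A K) (f ^ n) ∈ P := by
    apply hJP
    change IsIntegral A (algebraMap A K (f ^ n) * z)
    rw [hfz]
    exact isIntegral_algebraMap
  have hPc : P.comap (algebraMap A (integralClosure A K)) = q := by
    refine hq.eq_of_le (P.comap_isPrime _) (fun h ↦ ?_) hle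
    have h1 : f ^ n ∈ P.comap (algebraMap A (integralClosure A K)) := hfP
    rw [h, Ideal.mem_bot] at h1
    exact pow_ne_zero _ hf h1
  refine ⟨P, hP, ⟨hP, ?_⟩, ?_⟩
  · rw [hPc]
    refine ⟨⟨hqp, (Ideal.span_singleton_le_iff_mem _).mpr hfq⟩, fun p hp hpq ↦ ?_⟩
    have hp1 := hp.1
    refine (hq.eq_of_le hp.1 ?_ hpq).ge
    rintro rfl
    exact hf ((Ideal.span_singleton_le_iff_mem _).mp hp.2)
  · rintro ⟨y, hy⟩
    obtain ⟨⟨a, s⟩, has⟩ := IsLocalization.surj P.primeCompl y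
    have hNi : Function.Injective (algebraMap (integralClosure A K) (Localization.AtPrime P)) :=
      IsLocalization.injective _ P.primeCompl_le_nonZeroDivisors
    have h1 : algebraMap A (integralClosure A K) x * s =
        algebraMap A (integralClosure A K) (f ^ n) * a := by
      apply hNi
      rw [map_mul, map_mul, ← IsScalarTower.algebraMap_apply, ← IsScalarTower.algebraMap_apply,
        hy, ← has, map_pow]
      ring
    have h2 : algebraMap A K x * (s : integralClosure A K) = algebraMap A K (f ^ n) * (a : K) :=
      congrArg (algebraMap (integralClosure A K) K) h1
    refine s.2 (hJP ?_)
    change IsIntegral A (((s : integralClosure A K) : K) * z)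
    have h3 : ((s : integralClosure A K) : K) * z = a := by
      refine mul_left_cancel₀ hfK ?_
      rw [← map_pow, ← h2, ← hfz]
      ring
    rw [h3]
    exact a.2

end IntegralClosure

/-! ### Prime divisors of `Proj` of the normalized Rees algebra -/

lemma IsDiscreteValuationRing.addVal_ringEquiv {A B : Type*} [CommRing A] [IsDomain A]
    [IsDiscreteValuationRing A] [CommRing B] [IsDomain B] [IsDiscreteValuationRing B]
    (e : A ≃+* B) (x : A) : addVal B (e x) = addVal A x := by
  by_cases hx : x = 0
  · simp [hx]
  obtain ⟨ϖ, hϖ⟩ := exists_irreducible A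
  obtain ⟨n, u, rfl⟩ := eq_unit_mul_pow_irreducible hx hϖ
  rw [addVal_def' u hϖ n]
  refine addVal_def _ (Units.map e u) ((MulEquiv.irreducible_iff e).mpr hϖ) n ?_
  simp

namespace AlgebraicGeometry.Proj

open CategoryTheory

universe u

variable {σ : Type*} {A : Type u} [CommRing A] [SetLike σ A] [AddSubgroupClass σ A]
  (𝒜 : ℕ → σ) [GradedRing 𝒜] {m : ℕ} (hm : 0 < m) (F : A) (hF : F ∈ 𝒜 m)
  (p : PrimeSpectrum (CommRingCat.of (HomogeneousLocalization.Away 𝒜 F)))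

instance isIso_stalkMap_awayι : IsIso ((awayι 𝒜 F hF hm).stalkMap p) :=
  (fun _ ↦ inferInstance : ∀ x : Spec (CommRingCat.of (HomogeneousLocalization.Away 𝒜 F)),
    IsIso ((awayι 𝒜 F hF hm).stalkMap x)) p

/-- The stalk at a point of a standard chart. -/
def stalkIsoAway :
    (Proj 𝒜).presheaf.stalk (awayι 𝒜 F hF hm p) ≅ .of (Localization.AtPrime p.asIdeal) :=
  asIso ((awayι 𝒜 F hF hm).stalkMap p) ≪≫ Spec.stalkIso (CommRingCat.of _) p

/-- Reduces the pullback of functions to a stalk of `Proj` to the ring map `φ` into the chart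
followed by localization. -/
lemma germ_stalkIsoAway {R : CommRingCat.{u}} (g : Proj 𝒜 ⟶ Spec R)
    (φ : R ⟶ .of (HomogeneousLocalization.Away 𝒜 F)) (h : awayι 𝒜 F hF hm ≫ g = Spec.map φ) :
    (Scheme.ΓSpecIso R).inv ≫ g.appTop ≫ (Proj 𝒜).presheaf.germ ⊤ (awayι 𝒜 F hF hm p) trivial ≫
      (stalkIsoAway 𝒜 hm F hF p).hom =
      φ ≫ CommRingCat.ofHom (algebraMap _ (Localization.AtPrime p.asIdeal)) := by
  have h3 := Scheme.Hom.germ_stalkMap (awayι 𝒜 F hF hm) ⊤ p trivial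
  have h5 := Spec.germ_stalkMapIso_hom (R := CommRingCat.of (HomogeneousLocalization.Away 𝒜 F)) p
  rw [stalkIsoAway, Iso.trans_hom, asIso_hom, reassoc_of% h3]
  have h2 : g.appTop ≫ (awayι 𝒜 F hF hm).app ⊤ = (Spec.map φ).appTop := by
    rw [← h]; rfl
  rw [reassoc_of% h2]
  have h6 : (Scheme.ΓSpecIso R).inv ≫ (Spec.map φ).appTop ≫
      (Spec (CommRingCat.of (HomogeneousLocalization.Away 𝒜 F))).presheaf.germ ⊤ p trivial ≫
        (Spec.stalkIso (CommRingCat.of (HomogeneousLocalization.Away 𝒜 F)) p).hom =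
      φ ≫ CommRingCat.ofHom (algebraMap _ (Localization.AtPrime p.asIdeal)) := by
    rw [h5, ← Scheme.ΓSpecIso_inv_naturality_assoc]
    simp
  exact h6

/-- A prime of a standard chart whose local ring is a discrete valuation ring is the generic point
of a prime divisor. -/
theorem exists_coheight_eq_one {R : CommRingCat.{u}} (g : Proj 𝒜 ⟶ Spec R)
    (φ : R ⟶ .of (HomogeneousLocalization.Away 𝒜 F)) (h : awayι 𝒜 F hF hm ≫ g = Spec.map φ)
    {N : Type*} [CommRing N] [IsDomain N] (θ : HomogeneousLocalization.Away 𝒜 F ≃+* N)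
    (P : Ideal N) [P.IsPrime] [IsDiscreteValuationRing (Localization.AtPrime P)] :
    ∃ y : Proj 𝒜, Order.coheight y = 1 ∧
      ∃ (_ : IsDomain ((Proj 𝒜).presheaf.stalk y))
        (_ : IsDiscreteValuationRing ((Proj 𝒜).presheaf.stalk y)),
        ∀ r : R, IsDiscreteValuationRing.addVal ((Proj 𝒜).presheaf.stalk y)
          (((Scheme.ΓSpecIso R).inv ≫ g.appTop ≫ (Proj 𝒜).presheaf.germ ⊤ y trivial).hom r) =
          IsDiscreteValuationRing.addVal (Localization.AtPrime P)
            (algebraMap N (Localization.AtPrime P) (θ (φ.hom r))) := by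
  let p : PrimeSpectrum (CommRingCat.of (HomogeneousLocalization.Away 𝒜 F)) :=
    ⟨P.comap (θ : HomogeneousLocalization.Away 𝒜 F →+* N), inferInstance⟩
  have hM : p.asIdeal.primeCompl.map θ.toMonoidHom = P.primeCompl := by
    ext x
    constructor
    · rintro ⟨y, hy, rfl⟩
      exact hy
    · intro hx
      exact ⟨θ.symm x, fun h ↦ hx (by simpa [p] using h), by simp⟩
  let e : Localization.AtPrime p.asIdeal ≃+* Localization.AtPrime P :=
    IsLocalization.ringEquivOfRingEquiv _ _ θ hM
  have he : ∀ x, e (algebraMap _ _ x) = algebraMap N (Localization.AtPrime P) (θ x) :=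
    IsLocalization.ringEquivOfRingEquiv_eq hM
  let E : (Proj 𝒜).presheaf.stalk (awayι 𝒜 F hF hm p) ≃+* Localization.AtPrime P :=
    (stalkIsoAway 𝒜 hm F hF p).commRingCatIsoToRingEquiv.trans e
  have hE : ∀ r, E (((Scheme.ΓSpecIso R).inv ≫ g.appTop ≫
      (Proj 𝒜).presheaf.germ ⊤ (awayι 𝒜 F hF hm p) trivial).hom r) =
      algebraMap N (Localization.AtPrime P) (θ (φ.hom r)) := by
    intro r
    rw [← he]
    exact congrArg e (congrArg (fun ψ ↦ ψ.hom r) (germ_stalkIsoAway 𝒜 hm F hF p g φ h))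
  have hdom : IsDomain ((Proj 𝒜).presheaf.stalk (awayι 𝒜 F hF hm p)) := E.toMulEquiv.isDomain
  have hdvr := IsDiscreteValuationRing.RingEquivClass.isDiscreteValuationRing E.symm
  refine ⟨awayι 𝒜 F hF hm p, ?_, hdom, hdvr, fun r ↦ ?_⟩
  -- The codimension of a point is the dimension of its local ring, here a discrete valuation ring.
  · have h1 := ringKrullDim_stalk_eq_coheight (X := Proj 𝒜) (awayι 𝒜 F hF hm p)
    rw [IsDiscreteValuationRing.ringKrullDim_eq_one] at h1
    exact_mod_cast h1.symm
  · rw [← hE, IsDiscreteValuationRing.addVal_ringEquiv]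

end AlgebraicGeometry.Proj

namespace IdealFiltration

open AlgebraicGeometry CategoryTheory

universe u

variable {R : Type u} [CommRing R] (K : Type u) [Field K] [Algebra R K] (a : IdealFiltration R)

/-- The map from `R` to a standard chart of `Proj` of the normalized Rees algebra. -/
def toAway (F : a.normalizedRees K) :
    R →+* HomogeneousLocalization.Away (a.normalizedReesPart K) F :=
  (HomogeneousLocalization.fromZeroRingHom (a.normalizedReesPart K) (Submonoid.powers F)).comp
    (algebraMap R (a.normalizedReesPart K 0))

theorem isDivisorialValuation_of_away {m : ℕ} (hm : 0 < m) {F : a.normalizedRees K}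
    (hF : F ∈ a.normalizedReesPart K m) {N : Type*} [CommRing N] [IsDomain N]
    (θ : HomogeneousLocalization.Away (a.normalizedReesPart K) F ≃+* N)
    (P : Ideal N) [P.IsPrime] [IsDiscreteValuationRing (Localization.AtPrime P)]
    (v : AddValuation R ℕ∞)
    (hv : ∀ h : R, v h = IsDiscreteValuationRing.addVal (Localization.AtPrime P)
      (algebraMap N (Localization.AtPrime P) (θ (a.toAway K F h))))
    (htop : ∀ h : R, v h = ⊤ → h = 0) : a.IsDivisorialValuation K v := by
  have h1 : (Proj.awayι (a.normalizedReesPart K) F hF hm) ≫ a.normalizedProjMap K =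
      Spec.map (CommRingCat.ofHom (a.toAway K F)) := by
    refine (Proj.awayι_toSpecZero_assoc (a.normalizedReesPart K) F hF hm _).trans ?_
    rw [← Spec.map_comp]
    rfl
  obtain ⟨y, hy, hdom, hdvr, h⟩ :=
    Proj.exists_coheight_eq_one (a.normalizedReesPart K) hm F hF _ _ h1 θ P
  exact ⟨y, hy, ⟨hdom, hdvr, fun r ↦ (hv r).trans (h r).symm⟩, htop⟩

end IdealFiltration

/-! ### Valuative criteria -/

/-- An integrally closed subring of a field is the intersection of the valuation rings containing
it. -/
lemma isIntegral_of_forall_valuationSubring {B L : Type*} [CommRing B] [Field L] [Algebra B L]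
    {z : L} (h : ∀ V : ValuationSubring L, (∀ b, algebraMap B L b ∈ V) → z ∈ V) :
    IsIntegral B z := by
  by_contra hz
  have : IsIntegrallyClosedIn (integralClosure B L).toSubring L :=
    inferInstanceAs (IsIntegrallyClosedIn (integralClosure B L) L)
  obtain ⟨V, hV, hzV⟩ := Subring.exists_le_valuationSubring_of_isIntegrallyClosedIn
    (R := (integralClosure B L).toSubring) (x := z) hz
  exact hzV (h V fun b ↦ hV (show IsIntegral B (algebraMap B L b) from isIntegral_algebraMap))

lemma ValuationSubring.mem_of_isIntegral {B L : Type*} [CommRing B] [Field L] [Algebra B L]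
    {V : ValuationSubring L} (hV : ∀ b, algebraMap B L b ∈ V) {z : L} (hz : IsIntegral B z) :
    z ∈ V := by
  let φ : B →+* V := (algebraMap B L).codRestrict V.toSubring hV
  have h : IsIntegral V z := by
    have := hz.map_of_comp_eq φ (RingHom.id L) (by ext; rfl)
    simpa using this
  obtain ⟨y, rfl⟩ := IsIntegrallyClosed.isIntegral_iff.mp h
  exact y.2

/-- If `z` had valuation greater than 1, the term `z ^ n` would strictly dominate the sum. -/
lemma ValuationSubring.mem_of_eq_zero {L : Type*} [Field L] {V : ValuationSubring L} {z : L}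
    {n : ℕ} {c : ℕ → L} (hc : ∀ i, c i ∈ V)
    (h : z ^ n + ∑ i ∈ Finset.Icc 1 n, c i * z ^ (n - i) = 0) : z ∈ V := by
  rw [← V.valuation_le_one_iff]
  by_contra! hz
  have hz0 : V.valuation z ≠ 0 := (zero_lt_one.trans hz).ne'
  have h1 : V.valuation (z ^ n) < V.valuation z ^ n := by
    rw [eq_neg_of_add_eq_zero_left h, Valuation.map_neg]
    refine Valuation.map_sum_lt _ (pow_ne_zero _ hz0) fun i hi ↦ ?_
    rw [Finset.mem_Icc] at hi
    rw [map_mul, map_pow]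
    calc V.valuation (c i) * V.valuation z ^ (n - i)
        ≤ 1 * V.valuation z ^ (n - i) := by
          gcongr; exact (V.valuation_le_one_iff _).mpr (hc i)
      _ < V.valuation z ^ n := by
          rw [one_mul]
          exact pow_lt_pow_right₀ hz (by omega)
  rw [map_pow] at h1
  exact lt_irrefl _ h1

/-- Read off the coefficient of degree `n * N` in an integral equation of degree `N` for the
monomial. -/
lemma exists_eq_zero_of_isIntegral_monomial {Q S : Type*} [CommRing Q] [Nontrivial Q] [CommRing S]
    [Algebra S Q[X]] {n : ℕ} {x : Q} (h : IsIntegral S (monomial n x : Q[X])) :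
    ∃ N : ℕ, 1 ≤ N ∧ ∃ c : ℕ → Q, (∀ j, ∃ s : S, c j = (algebraMap S Q[X] s).coeff (n * j)) ∧
      x ^ N + ∑ i ∈ Finset.Icc 1 N, c i * x ^ (N - i) = 0 := by
  obtain ⟨p, hp, h0⟩ := h
  refine ⟨p.natDegree, Nat.one_le_iff_ne_zero.mpr fun hd ↦ ?_,
    fun j ↦ (algebraMap S Q[X] (p.coeff (p.natDegree - j))).coeff (n * j),
    fun j ↦ ⟨_, rfl⟩, ?_⟩
  · rw [(hp.natDegree_eq_zero).mp hd] at h0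
    simp at h0
  · have h1 := congrArg (fun q : Q[X] ↦ q.coeff (n * p.natDegree)) h0
    simp only [eval₂_eq_sum_range, finsetSum_coeff, coeff_zero] at h1
    have h2 : ∀ i ∈ Finset.range (p.natDegree + 1),
        (algebraMap S Q[X] (p.coeff i) * monomial n x ^ i).coeff (n * p.natDegree) =
          (algebraMap S Q[X] (p.coeff i)).coeff (n * (p.natDegree - i)) * x ^ i := by
      intro i hi
      rw [Finset.mem_range] at hi
      have : n * p.natDegree = n * (p.natDegree - i) + n * i := by
        rw [← mul_add, Nat.sub_add_cancel (by omega)]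
      rw [monomial_pow, this, coeff_mul_monomial]
    rw [Finset.sum_congr rfl h2, Finset.sum_range_succ, hp.coeff_natDegree] at h1
    simp only [map_one, Nat.sub_self, mul_zero, coeff_one_zero, one_mul] at h1
    rw [← h1, add_comm]
    congr 1
    refine Finset.sum_nbij' (fun i ↦ p.natDegree - i) (fun i ↦ p.natDegree - i) ?_ ?_ ?_ ?_ ?_
    all_goals intro i hi
    all_goals simp only [Finset.mem_range, Finset.mem_Icc] at hi ⊢
    any_goals omega
    rw [Nat.sub_sub_self hi.2]

/-! ### Charts of a blowup -/

section Chart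

variable {R : Type*} [CommRing R] (K : Type*) [Field K] [Algebra R K]

/-- The algebra `R[g / f : g ∈ S]`. -/
def blowupChart (S : Finset R) (f : R) : Subalgebra R K :=
  Algebra.adjoin R ((fun g ↦ algebraMap R K g / algebraMap R K f) '' S)

lemma div_mem_blowupChart {S : Finset R} (f : R) {g : R} (hg : g ∈ S) :
    algebraMap R K g / algebraMap R K f ∈ blowupChart K S f :=
  Algebra.subset_adjoin ⟨g, hg, rfl⟩

instance finiteType_blowupChart (S : Finset R) (f : R) :
    Algebra.FiniteType R (blowupChart K S f) := by
  classical
  rw [← Subalgebra.fg_iff_finiteType, blowupChart, ← Finset.coe_image]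
  exact Subalgebra.fg_adjoin_finset _

instance isNoetherianRing_blowupChart [IsNoetherianRing R] (S : Finset R) (f : R) :
    IsNoetherianRing (blowupChart K S f) := Algebra.FiniteType.isNoetherianRing R _

instance isFractionRing_blowupChart [IsFractionRing R K] (S : Finset R) (f : R) :
    IsFractionRing (blowupChart K S f) K :=
  IsFractionRing.of_field _ K fun z ↦ by
    obtain ⟨x, y, -, h⟩ := IsFractionRing.div_surjective (A := R) z
    exact ⟨algebraMap R _ x, algebraMap R _ y, h.symm⟩

/-- The extra variable is the one that `exists_height_one_prime_of_not_isIntegral` adjoins to the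
chart. -/
lemma isCatenaryRing_polynomial_blowupChart (hR : IsUniversallyCatenaryRing R)
    (S : Finset R) (f : R) : IsCatenaryRing (blowupChart K S f)[X] := by
  have : Algebra.FiniteType R (blowupChart K S f)[X] :=
    Algebra.FiniteType.trans (S := blowupChart K S f) inferInstance inferInstance
  exact hR.isCatenaryRing

variable {K}

lemma algebraMap_mem_valuationSubring_of_div_mem {S : Finset R} {f : R}
    {V : ValuationSubring K} (hR : ∀ r, algebraMap R K r ∈ V)
    (hS : ∀ g ∈ S, algebraMap R K g / algebraMap R K f ∈ V) (b : blowupChart K S f) :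
    (b : K) ∈ V := by
  obtain ⟨b, hb⟩ := b
  refine Algebra.adjoin_induction (p := fun x _ ↦ x ∈ V) ?_ hR
    (fun _ _ _ _ ↦ V.add_mem _ _) (fun _ _ _ _ ↦ V.mul_mem _ _) hb
  rintro _ ⟨g, hg, rfl⟩
  exact hS g hg

/-- `x ∈ R` is integral over `I ^ n` if it belongs to `f ^ n` times the integral closure of each
chart of the blowup of `I`. -/
theorem mem_integralClosureSet_of_isIntegral_blowupChart [IsDomain R] [IsFractionRing R K]
    {S : Finset R} {n : ℕ} {x : R} (hne : ∃ f ∈ S, f ≠ 0)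
    (h : ∀ f ∈ S, f ≠ 0 →
      IsIntegral (blowupChart K S f) (algebraMap R K x / algebraMap R K f ^ n)) :
    x ∈ (Ideal.span (S : Set R) ^ n).integralClosureSet := by
  set I := Ideal.span (S : Set R)
  suffices hi : IsIntegral (reesAlgebra I) (monomial n x : R[X]) by
    obtain ⟨N, hN, c, hc, h0⟩ := exists_eq_zero_of_isIntegral_monomial hi
    refine ⟨N, hN, c, fun i ↦ ?_, h0⟩
    obtain ⟨s, hs⟩ := hc i
    rw [hs, ← pow_mul]
    exact s.2 (n * i)
  let L := FractionRing R[X]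
  have hRX : Function.Injective (algebraMap R[X] L) := IsFractionRing.injective _ _
  suffices hL : IsIntegral (reesAlgebra I) (algebraMap R[X] L (monomial n x)) from
    (isIntegral_algebraMap_iff hRX).mp hL
  have hi : Function.Injective ((algebraMap R[X] L).comp C) := hRX.comp C_injective
  let j : K →+* L := IsFractionRing.lift hi
  have hj : ∀ r, j (algebraMap R K r) = algebraMap R[X] L (C r) := IsFractionRing.lift_algebraMap hi
  refine isIntegral_of_forall_valuationSubring fun V hV ↦ ?_
  obtain ⟨f₁, hf₁, hf₁0⟩ := hne
  -- Valuations are multiplicative, so maximality puts every `g / f` in `V`. The chart at this `f`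
  -- then maps into `V`, hence so does `x / f ^ n`, and `x T ^ n = (x / f ^ n) * (f T) ^ n`.
  obtain ⟨f, hf, hmax⟩ := S.exists_max_image (fun g ↦ V.valuation (algebraMap R[X] L (C g)))
    ⟨f₁, hf₁⟩
  have hC : ∀ g : R, g ≠ 0 → algebraMap R[X] L (C g) ≠ 0 := fun g hg ↦
    (map_ne_zero_iff _ hRX).mpr (C_ne_zero.mpr hg)
  have hf0 : f ≠ 0 := by
    rintro rfl
    have := hmax f₁ hf₁
    simp only [map_zero, le_zero_iff, map_eq_zero] at this
    exact hC f₁ hf₁0 this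
  have hRV : ∀ r, algebraMap R K r ∈ V.comap j := fun r ↦ by
    rw [ValuationSubring.mem_comap, hj]
    exact hV ⟨C r, (reesAlgebra I).algebraMap_mem r⟩
  have hgf : ∀ g ∈ S, algebraMap R K g / algebraMap R K f ∈ V.comap j := fun g hg ↦ by
    rw [ValuationSubring.mem_comap, map_div₀, hj, hj, ← V.valuation_le_one_iff, map_div₀]
    refine div_le_one_of_le₀ (hmax g hg) zero_le
  have h1 : algebraMap R K x / algebraMap R K f ^ n ∈ V.comap j :=
    ValuationSubring.mem_of_isIntegral (algebraMap_mem_valuationSubring_of_div_mem hRV hgf)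
      (h f hf hf0)
  rw [ValuationSubring.mem_comap, map_div₀, map_pow, hj, hj] at h1
  have h2 : algebraMap R[X] L (monomial 1 f) ∈ V :=
    hV ⟨monomial 1 f, reesAlgebra.monomial_mem.mpr (by
      rw [pow_one]; exact Ideal.subset_span hf)⟩
  have h3 : algebraMap R[X] L (monomial n x) =
      algebraMap R[X] L (C x) / algebraMap R[X] L (C f) ^ n *
        algebraMap R[X] L (monomial 1 f) ^ n := by
    rw [div_mul_eq_mul_div, eq_div_iff (pow_ne_zero _ (hC f hf0)), ← map_pow (algebraMap R[X] L),
      ← map_pow (algebraMap R[X] L), ← map_mul, ← map_mul, monomial_pow, ← C_pow, C_mul_monomial,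
      monomial_mul_C, one_mul]
  rw [h3]
  exact V.mul_mem _ _ h1 (V.toSubring.pow_mem h2 n)

end Chart

/-! ### Finitely generated Rees algebras and reduction sets -/

namespace IdealFiltration

section Generators

variable {R : Type*} [CommRing R] (a : IdealFiltration R)

lemma ideal_antitone : Antitone a.ideal := antitone_nat_of_succ_le a.ideal_succ_le

lemma mul_mem_ideal {p q : ℕ} {x y : R} (hx : x ∈ a.ideal p) (hy : y ∈ a.ideal q) :
    x * y ∈ a.ideal (p + q) := a.ideal_mul_le p q (Ideal.mul_mem_mul hx hy)

lemma pow_ideal_le (p n : ℕ) : a.ideal p ^ n ≤ a.ideal (p * n) := by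
  induction n with
  | zero => simp [a.ideal_zero]
  | succ n ih =>
    rw [pow_succ, mul_add_one]
    exact (Ideal.mul_mono_left ih).trans (a.ideal_mul_le _ _)

lemma pow_mem_ideal {p : ℕ} {x : R} (hx : x ∈ a.ideal p) (n : ℕ) : x ^ n ∈ a.ideal (p * n) :=
  a.pow_ideal_le p n (Ideal.pow_mem_pow hx n)

lemma monomial_mem_rees {p : ℕ} {x : R} (hx : x ∈ a.ideal p) : monomial p x ∈ a.rees := fun i ↦ by
  rw [coeff_monomial]
  split_ifs with h
  · exact h ▸ hx
  · exact zero_mem _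

/-- A finitely generated Rees algebra is generated by finitely many monomials of positive
degree. -/
lemma exists_monomial_generators (hfg : a.rees.FG) :
    ∃ T : Finset (ℕ × R), (∀ x ∈ T, 1 ≤ x.1 ∧ x.2 ≠ 0 ∧ x.2 ∈ a.ideal x.1) ∧
      a.rees ≤ Algebra.adjoin R ((fun x ↦ (monomial x.1 x.2 : R[X])) '' (T : Set (ℕ × R))) := by
  classical
  obtain ⟨s, hs⟩ := hfg
  refine ⟨{x ∈ s.biUnion fun q ↦ q.support.image fun i ↦ (i, q.coeff i) | 1 ≤ x.1},
    fun x hx ↦ ?_, ?_⟩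
  · simp only [Finset.mem_filter, Finset.mem_biUnion, Finset.mem_image] at hx
    obtain ⟨⟨q, hq, i, hi, rfl⟩, h1⟩ := hx
    have hq' : q ∈ a.rees := hs ▸ Algebra.subset_adjoin hq
    exact ⟨h1, mem_support_iff.mp hi, hq' i⟩
  · rw [← hs]
    refine Algebra.adjoin_le fun q hq ↦ ?_
    rw [SetLike.mem_coe, q.as_sum_support]
    refine sum_mem fun i hi ↦ ?_
    obtain rfl | h1 := Nat.eq_zero_or_pos i
    · exact Subalgebra.algebraMap_mem _ (q.coeff 0)
    · refine Algebra.subset_adjoin ⟨(i, q.coeff i), ?_, rfl⟩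
      simp only [Finset.coe_filter, Set.mem_ofPred_eq, Finset.mem_biUnion, Finset.mem_image]
      exact ⟨⟨q, hq, i, hi, rfl⟩, h1⟩

/-- A finite set `S ⊆ a_m` such that, roughly, `a_p ^ m` is integral over `(S) ^ p` for all `p`:
the valuation of `a_p` is bounded by that of `f`, for every valuation for which
`f` has minimal value among the elements of `S`. -/
structure IsReductionSet (K : Type*) [Field K] [Algebra R K] (m : ℕ) (S : Finset R) : Prop where
  pos : 0 < m
  mem : ∀ f ∈ S, f ∈ a.ideal m
  exists_ne_zero : ∃ f ∈ S, f ≠ 0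
  valuation_le : ∀ f ∈ S, ∀ V : ValuationSubring K, (∀ r, algebraMap R K r ∈ V) →
    (∀ g ∈ S, algebraMap R K g / algebraMap R K f ∈ V) → f ≠ 0 → ∀ p, ∀ y ∈ a.ideal p,
      V.valuation (algebraMap R K y) ^ m ≤ V.valuation (algebraMap R K f) ^ p

theorem exists_isReductionSet (K : Type*) [Field K] [Algebra R K] [IsDomain R]
    [IsFractionRing R K] (ha : a.ideal 1 ≠ ⊥) (hfg : a.rees.FG) :
    ∃ m S, a.IsReductionSet K m S := by
  classical
  obtain ⟨T, hT, hgen⟩ := a.exists_monomial_generators hfg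
  -- Any common multiple of the degrees serves: it lets each generator be raised to a power of
  -- degree exactly `m`.
  set m := ∏ x ∈ T, x.1
  have hm : 0 < m := Finset.prod_pos fun x hx ↦ (hT x hx).1
  have hdvd : ∀ x ∈ T, x.1 * (m / x.1) = m := fun x hx ↦
    Nat.mul_div_cancel' (Finset.dvd_prod_of_mem _ hx)
  refine ⟨m, T.image fun x ↦ x.2 ^ (m / x.1), hm, ?_, ?_, ?_⟩
  · simp only [Finset.mem_image]
    rintro _ ⟨x, hx, rfl⟩
    rw [← hdvd x hx, Nat.mul_div_cancel_left _ (hT x hx).1]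
    exact a.pow_mem_ideal (hT x hx).2.2 _
  -- Without generators of positive degree the Rees algebra would be `R`, contradicting `a_1 ≠ 0`.
  · obtain ⟨x, hx⟩ : T.Nonempty := by
      by_contra! h
      subst h
      obtain ⟨y, hy, hy0⟩ := Submodule.exists_mem_ne_zero_of_ne_bot ha
      have := hgen (a.monomial_mem_rees hy)
      rw [Finset.coe_empty, Set.image_empty, Algebra.adjoin_empty, Algebra.mem_bot] at this
      obtain ⟨r, hr⟩ := this
      have := congrArg (coeff · 1) hr
      simp only [algebraMap_eq, coeff_monomial_same, coeff_C, one_ne_zero, if_false] at this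
      exact hy0 this.symm
    exact ⟨_, Finset.mem_image_of_mem _ hx, pow_ne_zero _ (hT x hx).2.1⟩
  · intro f _ V hR hS hf0
    have hle : ∀ r, V.valuation (algebraMap R K r) ≤ 1 := fun r ↦
      (V.valuation_le_one_iff _).mpr (hR r)
    have hfK : V.valuation (algebraMap R K f) ≠ 0 := by simpa using hf0
    -- The bound, imposed on all coefficients of a polynomial, is stable under sums and products, so
    -- it suffices to check it on generators.
    suffices H : ∀ q ∈ Algebra.adjoin R ((fun x ↦ (monomial x.1 x.2 : R[X])) '' (T : Set (ℕ × R))),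
        ∀ p, V.valuation (algebraMap R K (q.coeff p)) ^ m ≤ V.valuation (algebraMap R K f) ^ p by
      intro p y hy
      have := H _ (hgen (a.monomial_mem_rees hy)) p
      rwa [coeff_monomial_same] at this
    have hadd : ∀ {γ} {x y : R}, V.valuation (algebraMap R K x) ^ m ≤ γ →
        V.valuation (algebraMap R K y) ^ m ≤ γ → V.valuation (algebraMap R K (x + y)) ^ m ≤ γ := by
      intro γ x y hx hy
      rw [map_add]
      rcases le_max_iff.mp (V.valuation.map_add (algebraMap R K x) (algebraMap R K y)) with h | h
      · exact (pow_le_pow_left₀ zero_le h m).trans hx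
      · exact (pow_le_pow_left₀ zero_le h m).trans hy
    have hzero : ∀ γ, V.valuation (algebraMap R K 0) ^ m ≤ γ := fun γ ↦ by
      rw [map_zero, map_zero, zero_pow hm.ne']
      exact zero_le
    intro q hq
    induction hq using Algebra.adjoin_induction with
    | mem q hq =>
      obtain ⟨x, hx, rfl⟩ := hq
      intro p
      rw [coeff_monomial]
      split_ifs with h
      · subst h
        rw [← hdvd x hx, mul_comm, pow_mul]
        refine pow_le_pow_left₀ zero_le ?_ _
        have := hS (x.2 ^ (m / x.1)) (Finset.mem_image_of_mem _ hx)
        rw [← V.valuation_le_one_iff, map_div₀, div_le_one₀ (zero_lt_iff.mpr hfK), map_pow,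
          map_pow] at this
        exact this
      · exact hzero _
    | algebraMap r =>
      intro p
      rw [algebraMap_eq, coeff_C]
      split_ifs with h
      · rw [h, pow_zero]
        exact pow_le_one₀ zero_le (hle r)
      · exact hzero _
    | add q q' _ _ h h' =>
      intro p
      rw [coeff_add]
      exact hadd (h p) (h' p)
    | mul q q' _ _ h h' =>
      intro p
      rw [coeff_mul]
      refine Finset.sum_induction _
        (fun z ↦ V.valuation (algebraMap R K z) ^ m ≤ V.valuation (algebraMap R K f) ^ p)
        (fun _ _ ↦ hadd) (hzero _) fun x hx ↦ ?_
      rw [← Finset.HasAntidiagonal.mem_antidiagonal.mp hx, map_mul, map_mul, mul_pow, pow_add]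
      exact mul_le_mul' (h _) (h' _)

end Generators

/-! ### Homogeneous elements of the normalized Rees algebra and blowup charts -/

section Chart

universe u

variable {R K : Type u} [CommRing R] [Field K] [Algebra R K] {a : IdealFiltration R}

namespace IsReductionSet

variable {m : ℕ} {S : Finset R} {f : R}

/-- The degree `m * k` part of the normalized Rees algebra is contained in `f ^ k` times the
integral closure of the chart at `f`. -/
lemma isIntegral_div (hS : a.IsReductionSet K m S) (hf : f ∈ S) (hf0 : algebraMap R K f ≠ 0)
    {k : ℕ} {b : K} (hb : IsIntegral (a.reesInK K) (monomial (m * k) b : K[X])) :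
    IsIntegral (blowupChart K S f) (b / algebraMap R K f ^ k) := by
  refine isIntegral_of_forall_valuationSubring fun V hV ↦ ?_
  have hR : ∀ r, algebraMap R K r ∈ V := fun r ↦ hV ⟨_, Subalgebra.algebraMap_mem _ r⟩
  have hgf : ∀ g ∈ S, algebraMap R K g / algebraMap R K f ∈ V := fun g hg ↦
    hV ⟨_, div_mem_blowupChart K f hg⟩
  have hle := hS.valuation_le f hf V hR hgf (by rintro rfl; simp at hf0)
  obtain ⟨N, -, c, hc, h0⟩ := exists_eq_zero_of_isIntegral_monomial hb
  refine ValuationSubring.mem_of_eq_zero (n := N)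
    (c := fun i ↦ c i / algebraMap R K f ^ (k * i)) (fun i ↦ ?_) ?_
  · obtain ⟨⟨_, q, hq, rfl⟩, h⟩ := hc i
    -- `c i` comes from `a_{mki}`, so its `m`-th power is bounded by `f ^ (m * k * i)`; extracting
    -- `m`-th roots bounds it by `f ^ (k * i)`.
    have h1 := hle (m * k * i) (q.coeff (m * k * i)) (hq _)
    have h2 : algebraMap R K (q.coeff (m * k * i)) = c i := by
      rw [h]
      exact (coeff_map (Algebra.ofId R K : R →+* K) _).symm
    rw [h2, mul_assoc, mul_comm m, pow_mul] at h1
    rw [← V.valuation_le_one_iff, map_div₀, map_pow,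
      div_le_one₀ (pow_pos (zero_lt_iff.mpr (by simpa using hf0)) _)]
    exact le_of_pow_le_pow_left₀ hS.pos.ne' zero_le h1
  · have h1 := congrArg (· / algebraMap R K f ^ (k * N)) h0
    simp only [add_div, zero_div, Finset.sum_div] at h1
    rw [← h1, div_pow, ← pow_mul]
    congr 1
    refine Finset.sum_congr rfl fun i hi ↦ ?_
    rw [Finset.mem_Icc] at hi
    rw [div_pow, ← pow_mul, div_mul_div_comm, ← pow_add, ← mul_add, Nat.add_sub_cancel' hi.2]

/-- Clears the denominators of an element of `R[g / f : g ∈ S]`. Asking for all large `k` lets the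
two summands of a sum share an exponent. -/
lemma exists_monomial_mul_pow_mem_reesInK (hS : a.IsReductionSet K m S) (hf : f ∈ S)
    (hf0 : algebraMap R K f ≠ 0) {c : K} (hc : c ∈ blowupChart K S f) :
    ∃ k₀, ∀ k, k₀ ≤ k → monomial (m * k) (c * algebraMap R K f ^ k) ∈ a.reesInK K := by
  have hmem : ∀ {p : ℕ} {x : R}, x ∈ a.ideal p → monomial p (algebraMap R K x) ∈ a.reesInK K :=
    fun hx ↦ ⟨_, a.monomial_mem_rees hx, by simp [Polynomial.map_monomial]⟩
  induction hc using Algebra.adjoin_induction with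
  | mem c hc =>
    obtain ⟨g, hg, rfl⟩ := hc
    refine ⟨1, fun k hk ↦ ?_⟩
    obtain ⟨k, rfl⟩ := Nat.exists_eq_add_of_le' hk
    have := hmem (a.mul_mem_ideal (a.pow_mem_ideal (hS.mem f hf) k) (hS.mem g hg))
    rw [mul_add_one]
    convert! this using 2
    rw [map_mul, map_pow, pow_succ]
    field_simp
  | algebraMap r =>
    refine ⟨0, fun k _ ↦ ?_⟩
    rw [← map_pow, ← map_mul]
    exact hmem (Ideal.mul_mem_left _ r (a.pow_mem_ideal (hS.mem f hf) k))
  | add c c' _ _ h h' =>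
    obtain ⟨k₁, h₁⟩ := h
    obtain ⟨k₂, h₂⟩ := h'
    refine ⟨max k₁ k₂, fun k hk ↦ ?_⟩
    rw [add_mul, map_add]
    exact add_mem (h₁ k ((le_max_left _ _).trans hk)) (h₂ k ((le_max_right _ _).trans hk))
  | mul c c' _ _ h h' =>
    obtain ⟨k₁, h₁⟩ := h
    obtain ⟨k₂, h₂⟩ := h'
    refine ⟨k₁ + k₂, fun k hk ↦ ?_⟩
    obtain ⟨k, rfl⟩ := Nat.exists_eq_add_of_le hk
    have := mul_mem (h₁ k₁ le_rfl) (h₂ (k₂ + k) (Nat.le_add_right _ _))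
    rw [monomial_mul_monomial, mul_mul_mul_comm, ← mul_add, ← pow_add, ← add_assoc] at this
    exact this

/-- Converse of `isIntegral_div`: a monic equation of degree `N` for `z` is homogenized by
multiplying it by `(f ^ k T ^ (m * k)) ^ N`. -/
lemma exists_isIntegral_monomial (hS : a.IsReductionSet K m S) (hf : f ∈ S)
    (hf0 : algebraMap R K f ≠ 0) {z : K} (hz : IsIntegral (blowupChart K S f) z) :
    ∃ k, IsIntegral (a.reesInK K) (monomial (m * k) (z * algebraMap R K f ^ k) : K[X]) := by
  obtain ⟨p, hp, h0⟩ := hz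
  choose k₀ hk₀ using fun i ↦ hS.exists_monomial_mul_pow_mem_reesInK hf hf0 (p.coeff i).2
  set N := p.natDegree
  -- The coefficient of `z ^ i` with `i < N` receives `f ^ (k * (N - i))`, and `k * (N - i) ≥ k`
  -- clears its denominator.
  set k := (Finset.range N).sup k₀
  refine ⟨k, ?_⟩
  have hk : ∀ i : Fin N, monomial (m * (k * (N - i)))
      ((p.coeff i : K) * algebraMap R K f ^ (k * (N - i))) ∈ a.reesInK K := fun i ↦ by
    refine hk₀ i _ ((Finset.le_sup (f := k₀) (Finset.mem_range.mpr i.2)).trans ?_)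
    exact Nat.le_mul_of_pos_right _ (Nat.sub_pos_of_lt i.2)
  let q : (a.reesInK K)[X] := X ^ N + ∑ i : Fin N, C ⟨_, hk i⟩ * X ^ (i : ℕ)
  refine ⟨q, monic_X_pow_add (degree_sum_fin_lt _), ?_⟩
  rw [eval₂_eq_sum_range, Finset.sum_range_succ, hp.coeff_natDegree] at h0
  have h1 := congrArg (fun y ↦ monomial (m * (k * N)) (y * algebraMap R K f ^ (k * N))) h0
  simp only [zero_mul, map_zero, add_mul, Finset.sum_mul, map_add, map_sum, map_one, one_mul] at h1
  simp only [q, eval₂_add, eval₂_X_pow, eval₂_finsetSum, eval₂_mul, eval₂_C]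
  rw [← h1, add_comm, ← Fin.sum_univ_eq_sum_range (fun i ↦ monomial (m * (k * N))
    (algebraMap _ K (p.coeff i) * z ^ i * algebraMap R K f ^ (k * N)))]
  congr 1
  · refine Finset.sum_congr rfl fun i _ ↦ ?_
    have hi : k * N = k * (N - i) + k * i := by
      rw [← mul_add, Nat.sub_add_cancel i.2.le]
    change monomial _ _ * _ = _
    rw [monomial_pow, monomial_mul_monomial, hi, mul_pow, ← pow_mul, mul_add, mul_assoc m k]
    congr 1
    rw [pow_add]
    change (p.coeff i : K) * _ * _ = (p.coeff i : K) * _ * _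
    ring
  · rw [monomial_pow, mul_pow, ← pow_mul, mul_assoc]

end IsReductionSet

end Chart

/-! ### Charts of `Proj` as integral closures of blowup charts -/

section AwayEquiv

universe u

variable {R K : Type u} [CommRing R] [Field K] [Algebra R K] {a : IdealFiltration R}

namespace IsReductionSet

variable {m : ℕ} {S : Finset R} {f : R}

/-- The monomial `f T ^ m` in the normalized Rees algebra. -/
def gen (hS : a.IsReductionSet K m S) (hf : f ∈ S) : a.normalizedRees K :=
  ⟨monomial m (algebraMap R K f), isIntegral_algebraMap
    (R := a.reesInK K) (A := K[X]) (x := ⟨_, _, a.monomial_mem_rees (hS.mem f hf), by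
      simp [Polynomial.map_monomial]⟩)⟩

lemma gen_mem (hS : a.IsReductionSet K m S) (hf : f ∈ S) :
    hS.gen hf ∈ a.normalizedReesPart K m := ⟨_, rfl⟩

/-- The substitution `T = 1` on the chart `f T ^ m ≠ 0`. -/
def awayEval (hS : a.IsReductionSet K m S) (hf : f ∈ S) (hf0 : algebraMap R K f ≠ 0) :
    HomogeneousLocalization.Away (a.normalizedReesPart K) (hS.gen hf) →+* K :=
  (IsLocalization.Away.lift (S := Localization.Away (hS.gen hf)) (hS.gen hf)
    (g := (evalRingHom 1).comp (a.normalizedRees K).val.toRingHom)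
    (isUnit_iff_ne_zero.mpr (by simpa [gen] using hf0))).comp
    (algebraMap (HomogeneousLocalization.Away (a.normalizedReesPart K) (hS.gen hf)) _)

lemma awayEval_mk (hS : a.IsReductionSet K m S) (hf : f ∈ S) (hf0 : algebraMap R K f ≠ 0)
    (k : ℕ) (x : a.normalizedRees K) (hx : x ∈ a.normalizedReesPart K (k • m)) :
    hS.awayEval hf hf0 (HomogeneousLocalization.Away.mk _ (hS.gen_mem hf) k x hx) =
      (x : K[X]).eval 1 / algebraMap R K f ^ k := by
  rw [eq_div_iff (pow_ne_zero _ hf0)]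
  set ψ : Localization.Away (hS.gen hf) →+* K := IsLocalization.Away.lift (hS.gen hf)
    (g := (evalRingHom 1).comp (a.normalizedRees K).val.toRingHom)
    (isUnit_iff_ne_zero.mpr (by simpa [gen] using hf0)) with hψ
  have h1 : ∀ y : a.normalizedRees K, ψ (algebraMap _ _ y) = (y : K[X]).eval 1 :=
    IsLocalization.Away.lift_eq _ _
  have h2 : algebraMap R K f ^ k = ψ (algebraMap _ _ (hS.gen hf ^ k)) := by
    rw [h1]
    simp [gen]
  rw [h2, ← h1 x]
  change ψ (Localization.mk x ⟨hS.gen hf ^ k, _⟩) * _ = _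
  rw [← map_mul, ← Localization.mk_one_eq_algebraMap, ← Localization.mk_one_eq_algebraMap,
    Localization.mk_mul]
  congr 1
  rw [Localization.mk_eq_mk_iff, Localization.r_iff_exists]
  exact ⟨1, by simp [mul_comm]⟩

lemma awayEval_toAway (hS : a.IsReductionSet K m S) (hf : f ∈ S) (hf0 : algebraMap R K f ≠ 0)
    (r : R) : hS.awayEval hf hf0 (a.toAway K (hS.gen hf) r) = algebraMap R K r := by
  have h0 : algebraMap R (a.normalizedRees K) r ∈ a.normalizedReesPart K (0 • m) :=
    ⟨algebraMap R K r, by rw [zero_smul, Subalgebra.coe_algebraMap]; rfl⟩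
  have h : a.toAway K (hS.gen hf) r =
      HomogeneousLocalization.Away.mk _ (hS.gen_mem hf) 0 _ h0 := by
    refine HomogeneousLocalization.val_injective _ ?_
    change Localization.mk _ _ = Localization.mk _ _
    rw [Localization.mk_eq_mk_iff, Localization.r_iff_exists]
    exact ⟨1, by simp⟩
  rw [h, awayEval_mk, pow_zero, div_one, Subalgebra.coe_algebraMap]
  exact eval_C

lemma awayEval_injective (hS : a.IsReductionSet K m S) (hf : f ∈ S) (hf0 : algebraMap R K f ≠ 0) :
    Function.Injective (hS.awayEval hf hf0) := by
  rw [injective_iff_map_eq_zero]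
  intro z hz
  obtain ⟨k, x, hx, rfl⟩ := HomogeneousLocalization.Away.mk_surjective _ (hS.gen_mem hf) z
  rw [awayEval_mk, div_eq_zero_iff, or_iff_left (pow_ne_zero _ hf0)] at hz
  obtain ⟨c, hc⟩ := id hx
  rw [hc, eval_monomial, one_pow, mul_one] at hz
  have hx0 : x = 0 := Subtype.ext (by rw [hc, hz, map_zero]; rfl)
  subst hx0
  refine HomogeneousLocalization.val_injective _ ?_
  rw [HomogeneousLocalization.Away.val_mk, Localization.mk_zero, HomogeneousLocalization.val_zero]

/-- The two directions are `isIntegral_div` and `exists_isIntegral_monomial`, applied to fractions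
`b T ^ (m * k) / (f T ^ m) ^ k`. -/
lemma range_awayEval (hS : a.IsReductionSet K m S) (hf : f ∈ S) (hf0 : algebraMap R K f ≠ 0)
    (z : K) : (∃ y, hS.awayEval hf hf0 y = z) ↔ IsIntegral (blowupChart K S f) z := by
  constructor
  · rintro ⟨y, rfl⟩
    obtain ⟨k, x, hx, rfl⟩ := HomogeneousLocalization.Away.mk_surjective _ (hS.gen_mem hf) y
    rw [awayEval_mk]
    obtain ⟨c, hc⟩ := id hx
    rw [hc, eval_monomial, one_pow, mul_one]
    refine hS.isIntegral_div hf hf0 ?_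
    rw [mul_comm, ← smul_eq_mul, ← hc]
    exact x.2
  · intro hz
    obtain ⟨k, hk⟩ := hS.exists_isIntegral_monomial hf hf0 hz
    have hmem : (⟨_, (a.mem_normalizedRees K).mpr hk⟩ : a.normalizedRees K) ∈
        a.normalizedReesPart K (k • m) := ⟨_, congrArg (monomial · _) (mul_comm m k)⟩
    refine ⟨HomogeneousLocalization.Away.mk _ (hS.gen_mem hf) k _ hmem, ?_⟩
    rw [awayEval_mk, eval_monomial, one_pow, mul_one, mul_div_cancel_right₀ _ (pow_ne_zero _ hf0)]

/-- The charts of `Proj` of the normalized Rees algebra are the integral closures of the charts of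
the blowup. -/
def awayEquiv (hS : a.IsReductionSet K m S) (hf : f ∈ S) (hf0 : algebraMap R K f ≠ 0) :
    HomogeneousLocalization.Away (a.normalizedReesPart K) (hS.gen hf) ≃+*
      integralClosure (blowupChart K S f) K :=
  RingEquiv.ofBijective
    ((hS.awayEval hf hf0).codRestrict (integralClosure (blowupChart K S f) K).toSubring
      fun y ↦ (hS.range_awayEval hf hf0 _).mp ⟨y, rfl⟩)
    ⟨fun x y h ↦ hS.awayEval_injective hf hf0 (congrArg Subtype.val h), fun z ↦ by
      obtain ⟨y, hy⟩ := (hS.range_awayEval hf hf0 z).mpr z.2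
      exact ⟨y, Subtype.ext hy⟩⟩

lemma awayEquiv_toAway (hS : a.IsReductionSet K m S) (hf : f ∈ S) (hf0 : algebraMap R K f ≠ 0)
    (r : R) : hS.awayEquiv hf hf0 (a.toAway K (hS.gen hf) r) =
      algebraMap R (integralClosure (blowupChart K S f) K) r :=
  Subtype.ext (hS.awayEval_toAway hf hf0 r)

end IsReductionSet

end AwayEquiv

end IdealFiltration

/-! ### Valuations and integral closures of ideals -/

section IntegralClosure

variable {R : Type*} [CommRing R] {I J : Ideal R}

lemma Ideal.integralClosureSet_mono (h : I ≤ J) : I.integralClosureSet ⊆ J.integralClosureSet := by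
  rintro x ⟨n, hn, c, hc, h0⟩
  exact ⟨n, hn, c, fun i ↦ Ideal.pow_right_mono h i (hc i), h0⟩

lemma Ideal.eq_top_of_one_mem_integralClosureSet (h : (1 : R) ∈ I.integralClosureSet) : I = ⊤ := by
  obtain ⟨n, -, c, hc, h0⟩ := h
  rw [Ideal.eq_top_iff_one, ← one_pow n, eq_neg_of_add_eq_zero_left h0]
  refine I.neg_mem (I.sum_mem fun i hi ↦ I.mul_mem_right _ ?_)
  exact Ideal.pow_le_self (by have := Finset.mem_Icc.mp hi; omega) (hc i)

namespace AddValuation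

variable (v : AddValuation R ℕ∞)

lemma idealValue_le {x : R} (hx : x ∈ I) : v.idealValue I ≤ v x := iInf₂_le x hx

lemma exists_idealValue_eq (I : Ideal R) : ∃ x ∈ I, v.idealValue I = v x := by
  obtain ⟨x, hx, h⟩ := csInf_mem (s := v '' I) ⟨_, 0, zero_mem _, rfl⟩
  exact ⟨x, hx, by rw [h, sInf_image]; rfl⟩

lemma mul_le_of_mem_pow {k : ℕ} (h : ∀ x ∈ I, (k : ℕ∞) ≤ v x) {i : ℕ} {x : R} (hx : x ∈ I ^ i) :
    ((i * k : ℕ) : ℕ∞) ≤ v x := by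
  induction i generalizing x with
  | zero => simp
  | succ i ih =>
    rw [pow_succ] at hx
    induction hx using Submodule.mul_induction_on' with
    | mem_mul_mem y hy z hz =>
      rw [v.map_mul, add_mul, one_mul, Nat.cast_add]
      exact add_le_add (ih hy) (h z hz)
    | add y _ z _ hy hz => exact v.map_le_add hy hz

/-- A valuation takes the same minimum on an ideal and its integral closure. -/
lemma idealValue_le_of_mem_integralClosureSet {x : R} (hx : x ∈ I.integralClosureSet) :
    v.idealValue I ≤ v x := by
  by_contra! hlt
  obtain ⟨n, hn, c, hc, h0⟩ := hx
  obtain ⟨k, hk⟩ := ENat.ne_top_iff_exists.mp hlt.ne_top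
  -- With `v x = k`, each `c i * x ^ (n - i)`, `i ≥ 1`, has value at least `i * (k + 1) + (n - i) *
  -- k > n * k`, so these terms cannot cancel `x ^ n`.
  have hI : ∀ y ∈ I, ((k + 1 : ℕ) : ℕ∞) ≤ v y := fun y hy ↦ by
    refine le_trans ?_ (v.idealValue_le hy)
    rw [← hk] at hlt
    exact_mod_cast Order.add_one_le_of_lt hlt
  have h1 : v (x ^ n) < v (x ^ n) := by
    conv_rhs => rw [eq_neg_of_add_eq_zero_left h0, v.map_neg]
    refine v.map_lt_sum' ?_ fun i hi ↦ ?_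
    · rw [v.map_pow, ← hk]
      exact_mod_cast ENat.natCast_lt_top (n • k)
    · rw [Finset.mem_Icc] at hi
      have h2 := v.mul_le_of_mem_pow hI (hc i)
      rw [v.map_mul, v.map_pow, v.map_pow, ← hk]
      refine lt_of_lt_of_le ?_ (add_le_add_left h2 _)
      obtain ⟨j, rfl⟩ := Nat.exists_eq_add_of_le hi.2
      rw [Nat.add_sub_cancel_left]
      simp only [nsmul_eq_mul]
      norm_cast
      nlinarith
  exact lt_irrefl _ h1

end AddValuation

end IntegralClosure

/-! ### Asymptotic values and the Łojasiewicz exponent -/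

namespace IdealFiltration

variable {R : Type*} [CommRing R] (a : IdealFiltration R)

lemma asymptoticValue_mul_le (v : AddValuation R ℕ∞) {p : ℕ} (hp : 1 ≤ p) {x : R}
    (hx : x ∈ a.ideal p) : a.asymptoticValue v * p ≤ (v x : ℝ≥0∞) := by
  rw [← ENNReal.le_div_iff_mul_le (.inl (by simp; omega)) (.inl (by simp))]
  refine (iInf₂_le p hp).trans (ENNReal.div_le_div_right ?_ _)
  exact ENat.toENNReal_le.mpr (v.idealValue_le hx)

lemma le_asymptoticValue (v : AddValuation R ℕ∞) {γ : ℝ≥0∞}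
    (h : ∀ p, 1 ≤ p → ∀ x ∈ a.ideal p, γ * p ≤ (v x : ℝ≥0∞)) : γ ≤ a.asymptoticValue v := by
  refine le_iInf₂ fun p hp ↦ ?_
  rw [ENNReal.le_div_iff_mul_le (.inl (by simp; omega)) (.inl (by simp))]
  obtain ⟨x, hx, hvx⟩ := v.exists_idealValue_eq (a.ideal p)
  rw [hvx]
  exact h p hp x hx

/-- The values of `a_p` under `v` are bounded below by `p * c / m`, and the bound is attained for
`p = m`. -/
structure IsComputedBy (v : AddValuation R ℕ∞) (m c : ℕ) : Prop where
  pos : 0 < c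
  le : ∀ p, ∀ x ∈ a.ideal p, ((p * c : ℕ) : ℕ∞) ≤ m * v x
  exists_eq : ∃ x ∈ a.ideal m, v x = c

namespace IsComputedBy

variable {a} {v : AddValuation R ℕ∞} {m c : ℕ}

lemma unique (hm : 0 < m) {c' : ℕ} (h : a.IsComputedBy v m c) (h' : a.IsComputedBy v m c') :
    c = c' := by
  have key : ∀ {c c' : ℕ}, a.IsComputedBy v m c → a.IsComputedBy v m c' → c ≤ c' := by
    intro c c' h h'
    obtain ⟨x, hx, hvx⟩ := h'.exists_eq
    have := h.le m x hx
    rw [hvx] at this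
    exact Nat.le_of_mul_le_mul_left (by exact_mod_cast this) hm
  exact le_antisymm (key h h') (key h' h)

lemma asymptoticValue_eq (hm : 0 < m) (h : a.IsComputedBy v m c) :
    a.asymptoticValue v = c / m := by
  have hm0 : (m : ℝ≥0∞) ≠ 0 := by simp; omega
  refine le_antisymm ?_ (a.le_asymptoticValue v fun p _ x hx ↦ ?_)
  · obtain ⟨x, hx, hvx⟩ := h.exists_eq
    rw [ENNReal.le_div_iff_mul_le (.inl hm0) (.inl (by simp))]
    refine (a.asymptoticValue_mul_le v hm hx).trans ?_
    simp [hvx]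
  · have h1 := ENat.toENNReal_le.mpr (h.le p x hx)
    rw [← ENNReal.mul_div_right_comm]
    refine ENNReal.div_le_of_le_mul' ?_
    simpa [mul_comm] using h1

lemma le_of_mem_integralClosureSet (h : a.IsComputedBy v m c) {p : ℕ} {x : R}
    (hx : x ∈ (a.ideal p).integralClosureSet) : ((p * c : ℕ) : ℕ∞) ≤ m * v x := by
  obtain ⟨y, hy, hvy⟩ := v.exists_idealValue_eq (a.ideal p)
  refine (h.le p y hy).trans ?_
  gcongr
  rw [← hvy]
  exact v.idealValue_le_of_mem_integralClosureSet hx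

/-- Testing the containment on powers of a single element removes the restriction to large `t` and
gives `v(b) ≥ c p / (q m)`. -/
lemma div_le_of_eventually (hm : 0 < m) (h : a.IsComputedBy v m c) {b : IdealFiltration R}
    {p q : ℕ} (hp : 1 ≤ p) (hq : 1 ≤ q)
    (hpq : ∀ᶠ t : ℕ in Filter.atTop,
      (b.ideal (q * t) : Set R) ⊆ (a.ideal (p * t)).integralClosureSet) :
    a.asymptoticValue v / b.asymptoticValue v ≤ (q : ℝ≥0∞) / p := by
  have hm0 : (m : ℝ≥0∞) ≠ 0 := by simp; omega
  have hp0 : (p : ℝ≥0∞) ≠ 0 := by simp; omega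
  have hq0 : (q : ℝ≥0∞) ≠ 0 := by simp; omega
  obtain ⟨s, hs⟩ := Filter.eventually_atTop.mp hpq
  have key : (c : ℝ≥0∞) * p / (q * m) ≤ b.asymptoticValue v := by
    refine b.le_asymptoticValue v fun r hr x hx ↦ ?_
    -- The hypothesis is used at `t = r * (s + 1)`, which is at least `s`; the positive factor `s +
    -- 1` cancels later.
    have h1 : x ^ (q * (s + 1)) ∈ (a.ideal (p * (r * (s + 1)))).integralClosureSet := by
      refine hs _ ((Nat.le_succ s).trans (Nat.le_mul_of_pos_left _ hr)) ?_
      rw [mul_left_comm]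
      exact b.pow_mem_ideal hx _
    have h2 := h.le_of_mem_integralClosureSet h1
    rw [← ENNReal.mul_div_right_comm]
    refine ENNReal.div_le_of_le_mul' ?_
    rcases eq_or_ne (v x) ⊤ with hx | hx
    · rw [hx, ENat.toENNReal_top, ENNReal.mul_top (mul_ne_zero hq0 hm0)]
      exact le_top
    · obtain ⟨k, hk⟩ := ENat.ne_top_iff_exists.mp hx
      rw [v.map_pow, ← hk, nsmul_eq_mul] at h2
      norm_cast at h2
      rw [← hk]
      have h3 : (c * p * r) * (s + 1) ≤ (q * m * k) * (s + 1) := by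
        calc _ = p * (r * (s + 1)) * c := by ring
          _ ≤ _ := h2
          _ = _ := by ring
      have := Nat.le_of_mul_le_mul_right h3 s.succ_pos
      simp only [ENat.toENNReal_coe]
      exact_mod_cast this
  rw [h.asymptoticValue_eq hm]
  refine ENNReal.div_le_of_le_mul (ENNReal.div_le_of_le_mul ?_)
  rw [← ENNReal.mul_div_right_comm, ← ENNReal.mul_div_right_comm,
    ENNReal.le_div_iff_mul_le (.inl hp0) (.inl (by simp))]
  rw [ENNReal.div_le_iff (mul_ne_zero hq0 hm0) (by finiteness)] at key
  exact key.trans_eq (by ring)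

/-- If `v(a) / v(b) < q / p`, then `v(b_{qt})` exceeds `(p t / m + 1) * c` for large `t`. -/
lemma eventually_le (hm : 0 < m) (h : a.IsComputedBy v m c) {b : IdealFiltration R}
    (hb : 0 < b.asymptoticValue v) {p q : ℕ} (hp : 1 ≤ p) (hq : 1 ≤ q)
    (hpq : a.asymptoticValue v / b.asymptoticValue v < (q : ℝ≥0∞) / p) :
    ∀ᶠ t : ℕ in Filter.atTop, ∀ x ∈ b.ideal (q * t), (((p * t / m + 1) * c : ℕ) : ℕ∞) ≤ v x := by
  have hm0 : (m : ℝ≥0∞) ≠ 0 := by simp; omega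
  have hp0 : (p : ℝ≥0∞) ≠ 0 := by simp; omega
  have hq0 : (q : ℝ≥0∞) ≠ 0 := by simp; omega
  have h1 : (p : ℝ≥0∞) * c < q * b.asymptoticValue v * m := by
    rw [h.asymptoticValue_eq hm, ENNReal.div_lt_iff (.inl hb.ne') (.inr (by finiteness)),
      ← ENNReal.mul_div_right_comm, ENNReal.div_lt_iff (.inl hm0) (.inl (by finiteness)),
      ← ENNReal.mul_div_right_comm, ENNReal.lt_div_iff_mul_lt (.inl hp0) (.inl (by finiteness))]
      at hpq
    rwa [mul_comm]
  -- The gap `ε` grows to `t * ε`, which for large `t` exceeds `m * c`, the cost of the `+ 1` in `p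
  -- * t / m + 1`.
  obtain ⟨ε, hε, h2⟩ := ENNReal.lt_iff_exists_add_pos_lt.mp h1
  obtain ⟨s, hs⟩ := Archimedean.arch (((m * c : ℕ) : NNReal)) hε
  filter_upwards [Filter.eventually_ge_atTop (s + 1)] with t ht x hx
  have h3 := b.asymptoticValue_mul_le v (Nat.mul_pos hq (by omega)) hx
  have h4 : ((m * c : ℕ) : ℝ≥0∞) ≤ t * ε := by
    have : ((m * c : ℕ) : NNReal) ≤ t * ε := by
      refine hs.trans ?_
      rw [nsmul_eq_mul]
      gcongr
      omega
    exact_mod_cast this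
  have h5 : (((p * t + m) * c : ℕ) : ℝ≥0∞) ≤ m * (v x : ℝ≥0∞) := by
    calc (((p * t + m) * c : ℕ) : ℝ≥0∞) = t * (p * c) + (m * c : ℕ) := by push_cast; ring
      _ ≤ t * (p * c) + t * ε := by gcongr
      _ = t * (p * c + ε) := by ring
      _ ≤ t * (q * b.asymptoticValue v * m) := by gcongr
      _ = m * (b.asymptoticValue v * (q * t : ℕ)) := by push_cast; ring
      _ ≤ m * (v x : ℝ≥0∞) := by gcongr
  rcases eq_or_ne (v x) ⊤ with hx | hx
  · simp [hx]
  · obtain ⟨k, hk⟩ := ENat.ne_top_iff_exists.mp hx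
    rw [← hk, ENat.toENNReal_coe] at h5
    norm_cast at h5
    rw [← hk, Nat.cast_le]
    refine Nat.le_of_mul_le_mul_left (le_trans ?_ h5) hm
    rw [← mul_assoc, mul_add_one]
    exact Nat.mul_le_mul_right _ (Nat.add_le_add_right (Nat.mul_div_le _ _) _)

end IsComputedBy

/-- The Łojasiewicz exponent is computed by any finite set of valuations that detect the integral
closures of the ideals `a_{mn}`. -/
theorem lojasiewicz_eq_sup' {V : Finset (AddValuation R ℕ∞)} (hV : V.Nonempty) {m : ℕ} (hm : 0 < m)
    {c : AddValuation R ℕ∞ → ℕ} (hc : ∀ v ∈ V, a.IsComputedBy v m (c v))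
    (h : ∀ n x, (∀ v ∈ V, ((n * c v : ℕ) : ℕ∞) ≤ v x) →
      x ∈ (a.ideal (m * n)).integralClosureSet)
    {b : IdealFiltration R} (hb : ∀ v ∈ V, 0 < b.asymptoticValue v) :
    b.lojasiewicz a = V.sup' hV (fun v ↦ a.asymptoticValue v / b.asymptoticValue v) := by
  refine le_antisymm (le_of_forall_gt fun r hr ↦ ?_) ?_
  -- A rational `s = q / p` strictly above the maximum and below `r` is itself admissible in the
  -- infimum.
  · obtain ⟨s, -, hs, hsr⟩ := ENNReal.lt_iff_exists_rat_btwn.mp hr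
    have hs0 : 0 < s := by
      by_contra! h0
      rw [Real.toNNReal_of_nonpos (by exact_mod_cast h0)] at hs
      exact not_lt_zero hs
    have hsq : ((Real.toNNReal s : NNReal) : ℝ≥0∞) = (s.num.toNat : ℝ≥0∞) / s.den := by
      have h1 : Real.toNNReal s = (s.num.toNat : NNReal) / s.den := by
        refine NNReal.eq ?_
        have h2 : ((s.num.toNat : ℤ) : ℝ) = s.num := by
          rw [Int.toNat_of_nonneg (Rat.num_nonneg.mpr hs0.le)]
        rw [Real.coe_toNNReal _ (by exact_mod_cast hs0.le), NNReal.coe_div, NNReal.coe_natCast,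
          NNReal.coe_natCast, ← Int.cast_natCast s.num.toNat, h2, ← Rat.cast_def]
      rw [h1, ENNReal.coe_div (by simp)]
      simp
    rw [hsq] at hs hsr
    have hq : 1 ≤ s.num.toNat := by
      have := Rat.num_pos.mpr hs0
      omega
    refine lt_of_le_of_lt (sInf_le ⟨s.den, s.num.toNat, s.den_pos, hq, ?_, rfl⟩) hsr
    · filter_upwards [(Filter.eventually_all_finset V).mpr fun v hv ↦
        (hc v hv).eventually_le hm (hb v hv) s.den_pos hq
          (((Finset.sup'_lt_iff hV).mp hs) v hv)] with t ht x hx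
      refine Ideal.integralClosureSet_mono (a.ideal_antitone ?_)
        (h (s.den * t / m + 1) x fun v hv ↦ ht v hv x hx)
      -- Here `/` is floor division: `m * (p t / m + 1)` is a multiple of `m` exceeding `p t`.
      exact (Nat.lt_mul_div_succ _ hm).le
  · refine Finset.sup'_le _ _ fun v hv ↦ le_sInf ?_
    rintro _ ⟨p, q, hp, hq, hpq, rfl⟩
    exact (hc v hv).div_le_of_eventually hm hp hq hpq

end IdealFiltration

/-! ### The valuations attached to the charts -/

namespace IdealFiltration

universe u

variable {R : Type u} (K : Type u) [CommRing R] [Field K] [Algebra R K]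

/-- `v` is the order along a prime of the integral closure of the chart at `f` that lies over a
minimal prime of `f`. -/
def IsChartValuation (S : Finset R) (f : R) (v : AddValuation R ℕ∞) : Prop :=
  ∃ P ∈ primesOverMinimalPrimes K (algebraMap R (blowupChart K S f) f), ∃ _ : P.IsPrime,
    ∃ _ : IsDiscreteValuationRing (Localization.AtPrime P), ∀ h : R,
      v h = IsDiscreteValuationRing.addVal (Localization.AtPrime P)
        (algebraMap (integralClosure (blowupChart K S f) K) _ (algebraMap R _ h))

lemma finite_setOf_isChartValuation [IsNoetherianRing R] [IsDomain R] [IsFractionRing R K]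
    (S : Finset R) {f : R} (hf : f ≠ 0) : {v | IsChartValuation K S f v}.Finite := by
  have hf' : algebraMap R (blowupChart K S f) f ≠ 0 := fun h ↦ hf <|
    IsFractionRing.injective R K (by simpa using congrArg Subtype.val h)
  refine ((finite_primesOverMinimalPrimes (K := K) hf').biUnion
    (t := fun P ↦ {v | ∃ _ : P.IsPrime,
      ∃ _ : IsDiscreteValuationRing (Localization.AtPrime P), ∀ h : R,
        v h = IsDiscreteValuationRing.addVal (Localization.AtPrime P)
          (algebraMap (integralClosure (blowupChart K S f) K) _ (algebraMap R _ h))})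
    fun P _ ↦ Set.Subsingleton.finite ?_).subset ?_
  · rintro v ⟨_, _, hv⟩ w ⟨_, _, hw⟩
    exact AddValuation.ext fun r ↦ (hv r).trans (hw r).symm
  · rintro v ⟨P, hP, h⟩
    exact Set.mem_biUnion hP h

section

variable {K}
variable [IsFractionRing R K] {S : Finset R} {f : R} {v : AddValuation R ℕ∞}

lemma IsChartValuation.eq_zero_of_eq_top (hv : IsChartValuation K S f v) {h : R} (hh : v h = ⊤) :
    h = 0 := by
  obtain ⟨P, hP, _, _, hv⟩ := hv
  rw [hv, IsDiscreteValuationRing.addVal_eq_top_iff] at hh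
  have hinj : Function.Injective (algebraMap (integralClosure (blowupChart K S f) K)
      (Localization.AtPrime P)) :=
    IsLocalization.injective (Localization.AtPrime P) P.primeCompl_le_nonZeroDivisors
  have h0 := (map_eq_zero_iff _ hinj).mp hh
  exact (map_eq_zero_iff _ (IsFractionRing.injective R K)).mp (congrArg Subtype.val h0)

variable {a : IdealFiltration R} {m : ℕ}

/-- Positivity holds because `f ∈ P`. For `y ∈ a_p`, the monomial `y ^ m T ^ (m * p)` lies in the
Rees algebra, so `f ^ p` divides `y ^ m` in the integral closure of the chart. -/
lemma IsChartValuation.isComputedBy [IsDomain R] (hv : IsChartValuation K S f v) (hS : a.IsReductionSet K m S)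
    (hf : f ∈ S) (hf0 : f ≠ 0) : ∃ c : ℕ, v f = c ∧ a.IsComputedBy v m c := by
  have htop : v f ≠ ⊤ := fun h ↦ hf0 (hv.eq_zero_of_eq_top h)
  obtain ⟨P, hP, _, _, hv⟩ := hv
  have hfK : algebraMap R K f ≠ 0 := (map_ne_zero_iff _ (IsFractionRing.injective R K)).mpr hf0
  obtain ⟨c, hc⟩ := ENat.ne_top_iff_exists.mp htop
  refine ⟨c, hc.symm, ?_, fun p y hy ↦ ?_, f, hS.mem f hf, hc.symm⟩
  · rw [Nat.pos_iff_ne_zero]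
    rintro rfl
    have hfP : algebraMap R (integralClosure (blowupChart K S f) K) f ∈ P :=
      hP.2.1.2 (Ideal.mem_span_singleton_self _)
    rw [hv, Nat.cast_zero, ← IsDiscreteValuationRing.addVal_one (R := Localization.AtPrime P)] at hc
    have hu := isUnit_of_dvd_one (IsDiscreteValuationRing.addVal_le_iff_dvd.mp hc.ge)
    exact (IsLocalRing.mem_maximalIdeal _).mp
      ((IsLocalization.AtPrime.to_map_mem_maximal_iff (Localization.AtPrime P) P _).mpr hfP) hu
  · have h1 : IsIntegral (a.reesInK K) (monomial (m * p) (algebraMap R K (y ^ m)) : K[X]) :=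
      isIntegral_algebraMap (R := a.reesInK K) (A := K[X]) (x := ⟨_, _,
        a.monomial_mem_rees (mul_comm p m ▸ a.pow_mem_ideal hy m), by
          simp [Polynomial.map_monomial]⟩)
    have h2 := hS.isIntegral_div hf hfK h1
    have h3 : algebraMap R (integralClosure (blowupChart K S f) K) f ^ p ∣
        algebraMap R (integralClosure (blowupChart K S f) K) y ^ m := by
      refine ⟨⟨_, h2⟩, Subtype.ext ?_⟩
      change algebraMap R K y ^ m = algebraMap R K f ^ p * _
      rw [mul_div_cancel₀ _ (pow_ne_zero _ hfK), map_pow]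
    have h4 := IsDiscreteValuationRing.addVal_le_iff_dvd.mpr
      (map_dvd (algebraMap _ (Localization.AtPrime P)) h3)
    rw [map_pow (algebraMap _ (Localization.AtPrime P)),
      map_pow (algebraMap _ (Localization.AtPrime P)), IsDiscreteValuationRing.addVal_pow,
      IsDiscreteValuationRing.addVal_pow, ← hv, ← hv, ← hc, nsmul_eq_mul, nsmul_eq_mul] at h4
    exact_mod_cast h4

lemma IsChartValuation.isDivisorialValuation (hv : IsChartValuation K S f v)
    (hS : a.IsReductionSet K m S) (hf : f ∈ S) (hf0 : f ≠ 0) : a.IsDivisorialValuation K v := by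
  have htop := fun h ↦ hv.eq_zero_of_eq_top (h := h)
  obtain ⟨P, hP, _, _, hv⟩ := hv
  have hfK : algebraMap R K f ≠ 0 := (map_ne_zero_iff _ (IsFractionRing.injective R K)).mpr hf0
  refine a.isDivisorialValuation_of_away K hS.pos (hS.gen_mem hf) (hS.awayEquiv hf hfK) P v
    (fun h ↦ ?_) htop
  rw [hv, hS.awayEquiv_toAway]

end

/-- The valuations of all charts detect the integral closures of the powers of `S`. -/
lemma mem_integralClosureSet_of_forall_isChartValuation [IsNoetherianRing R] [IsDomain R]
    [IsFractionRing R K] (hR : IsUniversallyCatenaryRing R) {S : Finset R} (hne : ∃ f ∈ S, f ≠ 0) {n : ℕ} {x : R}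
    (h : ∀ f ∈ S, f ≠ 0 → ∀ v, IsChartValuation K S f v → n • v f ≤ v x) :
    x ∈ (Ideal.span (S : Set R) ^ n).integralClosureSet := by
  refine mem_integralClosureSet_of_isIntegral_blowupChart (K := K) hne fun f hf hf0 ↦ ?_
  by_contra hx
  have hf' : algebraMap R (blowupChart K S f) f ≠ 0 := fun h ↦ hf0 <|
    IsFractionRing.injective R K (by simpa using congrArg Subtype.val h)
  obtain ⟨P, _, hP, hd⟩ := exists_mem_primesOverMinimalPrimes (K := K)
    (isCatenaryRing_polynomial_blowupChart K hR S f) (x := algebraMap R _ x) hf' hx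
  have := isDiscreteValuationRing_of_mem_primesOverMinimalPrimes hf' hP
  let v : AddValuation R ℕ∞ := (IsDiscreteValuationRing.addVal (Localization.AtPrime P)).comap
    ((algebraMap (integralClosure (blowupChart K S f) K) (Localization.AtPrime P)).comp
      (algebraMap R _))
  have hv := h f hf hf0 v ⟨P, hP, inferInstance, this, fun _ ↦ rfl⟩
  apply hd
  rw [← IsDiscreteValuationRing.addVal_le_iff_dvd, IsDiscreteValuationRing.addVal_pow]
  exact hv

end IdealFiltration

end

theorem mainTheorem1 {R : Type*} [CommRing R] [IsDomain R] [IsLocalRing R] [IsExcellentRing R]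
    (a : IdealFiltration R) (ha : a.ideal 1 ≠ ⊥) (hfg : a.rees.FG) :
    ∃ (V : Finset (AddValuation R ℕ∞)) (hV : V.Nonempty),
      (∀ v ∈ V, a.IsDivisorialValuation (FractionRing R) v ∧ ∀ x ∈ a.ideal 1, 0 < v x) ∧
      ∀ b : IdealFiltration R, (∀ v ∈ V, 0 < b.asymptoticValue v) →
        b.lojasiewicz a = V.sup' hV (fun v ↦ a.asymptoticValue v / b.asymptoticValue v) := by
  obtain ⟨m, S, hS⟩ := a.exists_isReductionSet (FractionRing R) ha hfg
  have hfin : {v | ∃ f ∈ S, f ≠ 0 ∧ IdealFiltration.IsChartValuation (FractionRing R) S f v}.Finite := by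
    refine (S.finite_toSet.biUnion (t := fun f ↦ {v | f ≠ 0 ∧
      IdealFiltration.IsChartValuation (FractionRing R) S f v}) fun f _ ↦ ?_).subset ?_
    · by_cases hf : f = 0
      · simp [hf]
      · exact (IdealFiltration.finite_setOf_isChartValuation _ S hf).subset fun v hv ↦ hv.2
    · rintro v ⟨f, hf, hv⟩
      exact Set.mem_biUnion hf hv
  set V := hfin.toFinset
  have hmem : ∀ v, v ∈ V ↔ ∃ f ∈ S, f ≠ 0 ∧ IdealFiltration.IsChartValuation (FractionRing R) S f v := fun v ↦
    hfin.mem_toFinset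
  have hex : ∀ v, ∃ c, v ∈ V → a.IsComputedBy v m c := fun v ↦ by
    by_cases hv : v ∈ V
    · obtain ⟨f, hf, hf0, hv⟩ := (hmem v).mp hv
      obtain ⟨c, -, hc⟩ := hv.isComputedBy hS hf hf0
      exact ⟨c, fun _ ↦ hc⟩
    · exact ⟨0, fun h ↦ (hv h).elim⟩
  choose c hc using hex
  have hdetect : ∀ n x, (∀ v ∈ V, ((n * c v : ℕ) : ℕ∞) ≤ v x) →
      x ∈ (a.ideal (m * n)).integralClosureSet := fun n x h ↦ by
    have hSm : Ideal.span (S : Set R) ^ n ≤ a.ideal (m * n) :=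
      (Ideal.pow_right_mono (Ideal.span_le.mpr hS.mem) n).trans (a.pow_ideal_le m n)
    refine Ideal.integralClosureSet_mono hSm
      (IdealFiltration.mem_integralClosureSet_of_forall_isChartValuation (FractionRing R)
        IsExcellentRing.universallyCatenary hS.exists_ne_zero fun f hf hf0 v hv ↦ ?_)
    have hvV := (hmem v).mpr ⟨f, hf, hf0, hv⟩
    obtain ⟨c', hc', hv'⟩ := hv.isComputedBy hS hf hf0
    have := h v hvV
    -- One valuation may arise from several charts; uniqueness identifies its chosen constant with
    -- `v f` for the present `f`.
    rw [(hc v hvV).unique hS.pos hv'] at this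
    rw [hc', nsmul_eq_mul]
    exact_mod_cast this
  -- If `V` were empty, detection would be vacuous and `1` would be integral over the proper ideal
  -- `a_m`.
  have hV : V.Nonempty := by
    by_contra! hV
    have h1 := hdetect 1 1 (by simp [hV])
    rw [mul_one] at h1
    exact a.ideal_ne_top m hS.pos (Ideal.eq_top_of_one_mem_integralClosureSet h1)
  refine ⟨V, hV, fun v hv ↦ ⟨?_, fun x hx ↦ ?_⟩, fun b hb ↦
    a.lojasiewicz_eq_sup' hV hS.pos hc hdetect hb⟩
  · obtain ⟨f, hf, hf0, hv⟩ := (hmem v).mp hv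
    exact hv.isDivisorialValuation hS hf hf0
  · have h1 := (hc v hv).le 1 x hx
    rw [pos_iff_ne_zero]
    intro h0
    rw [h0, mul_zero, one_mul, nonpos_iff_eq_zero] at h1
    exact (hc v hv).pos.ne' (by exact_mod_cast h1)
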